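/- Let $r\ge 1$ be an integer, $q=2^r$. Two bases $u_1,\dots,u_d$ and $v_1,\dots,v_d$ of $\mathbb{R}^d$, both orthonormal for a positive definite symmetric bilinear form $g$, are *mutually unbiased* if $g(u_i,v_j)^2=1/d$ for all $i,j$. An orthogonal matrix is identified with the orthonormal basis formed by its columns. (1) There is a $q^2\times q^2$ real orthogonal matrix $D$ of multiplicative order $q+1$ (so $D^{q+1}=I$) whose $q+1$ powers $D,D^2,\dots,D^{q+1}=I$ give $q+1$ pairwise mutually unbiased orthonormal bases of $\mathbb{R}^{q^2}$, and $qD,qD^2,\dots,qD^q$ are $q$ distinct real Hadamard matrices. (2) For every $q^2\times q^2$ real orthogonal matrix $D$ with $D^{q+1}=I$, the powers $D,D^2,\dots,D^{q+1}$ give pairwise mutually unbiased bases if and only if $qD,\dots,qD^q$ are $q$ distinct Hadamard matrices. (3) Matrices as in (1) arise as follows. Let $V$ be a two-dimensional vector space over $\mathbb{F}_{q^2}$ with a non-degenerate hermitian form $f$ (linear in the first variable, $f(v,u)=f(u,v)^q$), and let $G=V\times\mathbb{F}_{q^2}$ be the group with multiplication $(u,a)(v,b)=(u+v,\,f(u,v)+a+b)$.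 Then: * There is a one-dimensional totally isotropic subspace of $V$. There is an isometry $\sigma$ of $(V,f)$ with $\sigma(u_1)=\lambda u_1$, $\sigma(u_2)=u_2$ for some $u_1,u_2$ with $f(u_1,u_1)=f(u_2,u_2)=1$, $f(u_1,u_2)=0$ and some $\lambda\in\mathbb{F}_{q^2}^\times$ of order $q+1$; every such $\sigma$ has order $q+1$. It induces the automorphism $\hat\sigma(u,a)=(\sigma(u),a)$ of $G$. * $G$ has an irreducible complex representation of degree $q^2$, and the character $\chi$ of any such representation is the character of a representation $X$ of $G$ on the real vector space $\mathbb{R}^{q^2}$. Any such $X$ preserves some positive definite symmetric bilinear form on $\mathbb{R}^{q^2}$. * Let $\chi$ and $X$ be as above, let $B$ be any positive definite symmetric bilinear form preserved by $X$, and let $\sigma$ be as above. There is a linear automorphism $D$ of $\mathbb{R}^{q^2}$ which preserves $B$ and satisfies $D^{q+1}=I$ and $X(\hat\sigma(x))=DX(x)D^{-1}$ for all $x\in G$. * Let moreover $U$ be any one-dimensional totally isotropic subspace of $V$, and put $\hat U=\{(u,0):u\in U\}$. There is a $B$-orthonormal basis of $\mathbb{R}^{q^2}$ consisting of simultaneous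 eigenvectors of the operators $X(x)$, $x\in\hat U$. For every $D$ as in the previous item and every such basis $X_1,\dots,X_{q^2}$, the $q+1$ bases $D^kX_1,\dots,D^kX_{q^2}$ ($1\le k\le q+1$) are pairwise mutually unbiased with respect to $B$. The matrix of $D$ with respect to $X_1,\dots,X_{q^2}$ is orthogonal, and it has all the properties required of the matrix in (1). -/

import Mathlib

section HermitianGroup

variable {K V : Type*} [Field K] [AddCommGroup V] [Module K V] {τ : K →+* K}

/-- A form `f` on `V`, linear in the first variable and semilinear in the second, is a
non-degenerate hermitian form (over the field with `q ^ 2` elements) if `f v u = (f u v) ^ q`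
and only `u = 0` satisfies `f u w = 0` for all `w`. -/
structure IsNondegenerateHermitian (q : ℕ) (f : V →ₗ[K] V →ₛₗ[τ] K) : Prop where
  hermitian : ∀ u v, f v u = f u v ^ q
  nondegenerate : ∀ u, (∀ w, f u w = 0) → u = 0

/-- The underlying set `V × K` of the group attached to the form `f`. -/
@[ext]
structure HermitianGroup (f : V →ₗ[K] V →ₛₗ[τ] K) where
  vec : V
  scal : K

/-- The group law `(u, a) (v, b) = (u + v, f u v + a + b)`. -/
instance HermitianGroup.instGroup (f : V →ₗ[K] V →ₛₗ[τ] K) : Group (HermitianGroup f) where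
  mul x y := ⟨x.vec + y.vec, f x.vec y.vec + x.scal + y.scal⟩
  one := ⟨0, 0⟩
  inv x := ⟨-x.vec, f x.vec x.vec - x.scal⟩
  mul_assoc x y z := by
    apply HermitianGroup.ext
    · exact add_assoc _ _ _
    · change f (x.vec + y.vec) z.vec + (f x.vec y.vec + x.scal + y.scal) + z.scal
        = f x.vec (y.vec + z.vec) + x.scal + (f y.vec z.vec + y.scal + z.scal)
      simp only [map_add, LinearMap.add_apply]
      ring
  one_mul x := by
    apply HermitianGroup.ext
    · exact zero_add _
    · change f 0 x.vec + 0 + x.scal = x.scal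
      simp
  mul_one x := by
    apply HermitianGroup.ext
    · exact add_zero _
    · change f x.vec 0 + x.scal + 0 = x.scal
      simp
  inv_mul_cancel x := by
    apply HermitianGroup.ext
    · exact neg_add_cancel _
    · change f (-x.vec) x.vec + (f x.vec x.vec - x.scal) + x.scal = 0
      simp only [map_neg, LinearMap.neg_apply]
      ring

/-- The unitary group of `f`: the group of all linear isometries of `V`. -/
def isometryGroup (f : V →ₗ[K] V →ₛₗ[τ] K) : Subgroup (V ≃ₗ[K] V) where
  carrier := {σ | ∀ u v, f (σ u) (σ v) = f u v}
  mul_mem' {σ ρ} hσ hρ u v := (hσ (ρ u) (ρ v)).trans (hρ u v)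
  one_mem' _ _ := rfl
  inv_mem' {σ} hσ u v := by
    have h := hσ (σ⁻¹ u) (σ⁻¹ v)
    have e : ∀ w, σ (σ⁻¹ w) = w := fun w => σ.apply_symm_apply w
    rw [e, e] at h
    exact h.symm

/-- The automorphism `(u, a) ↦ (σ u, a)` induced by an isometry `σ`. -/
def isometryHat (f : V →ₗ[K] V →ₛₗ[τ] K) (σ : isometryGroup f) : MulAut (HermitianGroup f) where
  toFun x := ⟨σ.1 x.vec, x.scal⟩
  invFun x := ⟨σ.1.symm x.vec, x.scal⟩
  left_inv x := HermitianGroup.ext (σ.1.symm_apply_apply x.vec) rfl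
  right_inv x := HermitianGroup.ext (σ.1.apply_symm_apply x.vec) rfl
  map_mul' x y := by
    apply HermitianGroup.ext
    · exact map_add σ.1 x.vec y.vec
    · change f x.vec y.vec + x.scal + y.scal = f (σ.1 x.vec) (σ.1 y.vec) + x.scal + y.scal
      rw [σ.2 x.vec y.vec]

/-- `σ` multiplies the first vector of an orthonormal basis `u₁, u₂` of the plane `V` by an
element `c` of multiplicative order `q + 1`, and fixes the second one. -/
def IsDiagonalIsometry (q : ℕ) (f : V →ₗ[K] V →ₛₗ[τ] K) (σ : isometryGroup f) : Prop :=
  ∃ (u₁ u₂ : V) (c : K), f u₁ u₁ = 1 ∧ f u₂ u₂ = 1 ∧ f u₁ u₂ = 0 ∧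
    orderOf c = q + 1 ∧ σ.1 u₁ = c • u₁ ∧ σ.1 u₂ = u₂

/-- One-dimensional totally isotropic subspaces. -/
def IsIsotropicLine (f : V →ₗ[K] V →ₛₗ[τ] K) (U : Submodule K V) : Prop :=
  Module.finrank K U = 1 ∧ ∀ u ∈ U, ∀ v ∈ U, f u v = 0

/-- The subset `{(u, 0) : u ∈ U}` of the group. -/
def lineHat (f : V →ₗ[K] V →ₛₗ[τ] K) (U : Submodule K V) : Set (HermitianGroup f) :=
  {x | x.vec ∈ U ∧ x.scal = 0}

end HermitianGroup

section RealForms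

variable {G : Type*} [Group G]

/-- The real representation `X` on `ℝ ^ d` affords the character of the complex
representation `ρ`. -/
def IsRealFormOf {d : ℕ} (X : Representation ℝ G (Fin d → ℝ))
    (ρ : Representation ℂ G (Fin d → ℂ)) : Prop :=
  ∀ x, ((X.character x : ℝ) : ℂ) = ρ.character x

/-- `B` is a positive definite symmetric bilinear form preserved by `X`. -/
structure IsInvariantForm {W : Type*} [AddCommGroup W] [Module ℝ W]
    (X : Representation ℝ G W) (B : LinearMap.BilinForm ℝ W) : Prop where
  symm : ∀ v w, B v w = B w v
  pos : ∀ v, v ≠ 0 → 0 < B v v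
  invariant : ∀ x v w, B (X x v) (X x w) = B v w

/-- `D` implements the automorphism `α` on `X`, that is `X (α x) = D X(x) D⁻¹` for all `x`,
it satisfies `D ^ (q + 1) = 1`, and it preserves `B`. -/
structure IsNormalizedIntertwiner {W : Type*} [AddCommGroup W] [Module ℝ W] (q : ℕ)
    (X : Representation ℝ G W) (B : LinearMap.BilinForm ℝ W) (α : MulAut G)
    (D : W ≃ₗ[ℝ] W) : Prop where
  conj : ∀ x w, X (α x) w = D (X x (D⁻¹ w))
  pow_eq_one : D ^ (q + 1) = 1
  preserves : ∀ v w, B (D v) (D w) = B v w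

end RealForms

section UnbiasedBases

variable {ι W : Type*} [Fintype ι] [DecidableEq ι] [AddCommGroup W] [Module ℝ W]

/-- The family `u` is a basis of `W` that is orthonormal with respect to `g`. -/
structure IsOrthonormalBasis (g : LinearMap.BilinForm ℝ W) (u : ι → W) : Prop where
  linearIndependent : LinearIndependent ℝ u
  span_eq_top : Submodule.span ℝ (Set.range u) = ⊤
  orthonormal : ∀ i j, g (u i) (u j) = if i = j then 1 else 0

/-- Mutually unbiased (orthonormal) bases with respect to `g`. -/
structure MutuallyUnbiased (g : LinearMap.BilinForm ℝ W) (u v : ι → W) : Prop where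
  left : IsOrthonormalBasis g u
  right : IsOrthonormalBasis g v
  unbiased : ∀ i j, g (u i) (v j) ^ 2 = 1 / (Fintype.card ι : ℝ)

/-- The columns of the `q + 1` matrices `D, D ^ 2, …, D ^ (q + 1)` are pairwise mutually
unbiased orthonormal bases for the standard inner product. -/
def PowersMutuallyUnbiased (q : ℕ) (D : Matrix ι ι ℝ) : Prop :=
  ∀ j ∈ Set.Icc 1 (q + 1), ∀ k ∈ Set.Icc 1 (q + 1), j ≠ k →
    MutuallyUnbiased (dotProductBilin ℝ ℝ : LinearMap.BilinForm ℝ (ι → ℝ))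
      (fun i => (D ^ j).col i) (fun i => (D ^ k).col i)

/-- `qD, qD ^ 2, …, qD ^ q` are `q` different Hadamard matrices. -/
def PowersHadamard (q : ℕ) (D : Matrix ι ι ℝ) : Prop :=
  (∀ k ∈ Set.Icc 1 q, ((q : ℝ) • D ^ k).IsHadamard) ∧
    Set.InjOn (fun k : ℕ => (q : ℝ) • D ^ k) (Set.Icc 1 q)

end UnbiasedBases

/-!
Write `T v` for the operator of `(v, 0)` in a representation of the group `G` attached to a
hermitian plane `V`. The center `0 × K` acts through a character `ψ : K → {±1}`, so
`T u * T v = ψ (f u v) • T (u + v)`, and `T u`, `T v` commute up to the sign `ψ (f u v + f v u)`.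
When the degree is larger than one, `ψ` is nontrivial on the traces `t + t ^ q`; then this pairing
is non-degenerate and `T v` has trace zero for `v ≠ 0`. In degree `q ^ 2` the `q ^ 4` operators
`T v` thus form a basis of the endomorphism algebra (`HasCentralCharacter.exists_basis`). Over any
field of characteristic zero, this gives irreducibility, Schur's lemma with scalar commutant, and
uniqueness of the representation for given `ψ` (the map between two such bases is an algebra
automorphism, hence inner). A decomposition of `V` into two isotropic lines yields an explicit
representation, over `ℝ` as well because `ψ` is real.

An isometry `σ` fixes the center, so uniqueness provides an operator `D` that implements it. By
Schur's lemma `D ^ (q + 1)` is a scalar, and `D` can be normalized as `q + 1` is odd; since invariant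
forms are unique up to scalars, `D` then preserves `B` (`exists_isNormalizedIntertwiner`).

If `e` is a unit eigenvector of all `T u` with `u` in an isotropic line `U`, then the `T w e`, for
`w` in a complement of `U`, belong to different characters of `U` and form an orthonormal basis
(`IsLineEigenvector.isOrthonormalBasis_apply`). With another isotropic line `U'` as the complement,
and `e'` a unit eigenvector for `U'`, all `q ^ 2` coefficients of `e'` in this basis are `± B e e'`, so
Parseval's identity gives `B e e' ^ 2 = 1 / q ^ 2` (`IsLineEigenvector.apply_sq_eq`). Finally `D ^ m`
maps eigenvectors for `U` to eigenvectors for `σ ^ m U`, and `σ ^ m U ≠ U` for `1 ≤ m ≤ q`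
(`IsDiagonalIsometry.eq_zero_of_pow_apply_mem`).

For an orthogonal matrix `D` of order dividing `q + 1`, the inner products of columns of `D ^ j` and
`D ^ k` are entries of `D ^ (k - j)`. Both formulations of the conclusion therefore say that all
entries of `D, …, D ^ q` are `± 1 / q` (`HasFlatPowers`).
-/

/-! ### Orthonormal bases of a bilinear form -/

namespace IsOrthonormalBasis

variable {ι W : Type*} [Fintype ι] [DecidableEq ι] [AddCommGroup W] [Module ℝ W]
  {g : LinearMap.BilinForm ℝ W} {u : ι → W}

theorem of_card_eq_finrank [FiniteDimensional ℝ W]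
    (h : ∀ i j, g (u i) (u j) = if i = j then 1 else 0)
    (hcard : Fintype.card ι = Module.finrank ℝ W) : IsOrthonormalBasis g u := by
  have hli : LinearIndependent ℝ u := by
    rw [Fintype.linearIndependent_iff]
    intro c hc i
    have := congrArg (g (u i)) hc
    simpa [h] using this
  exact ⟨hli, hli.span_eq_top_of_card_eq_finrank' hcard, h⟩

theorem eq_sum (hu : IsOrthonormalBasis g u) (x : W) : x = ∑ i, g (u i) x • u i := by
  obtain ⟨c, rfl⟩ := (Submodule.mem_span_range_iff_exists_fun ℝ).1
    (hu.span_eq_top ▸ Submodule.mem_top : x ∈ Submodule.span ℝ (Set.range u))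
  refine Finset.sum_congr rfl fun i _ => ?_
  simp [hu.orthonormal]

/-- Parseval's identity. -/
theorem apply_self_eq_sum_sq (hu : IsOrthonormalBasis g u) (x : W) :
    g x x = ∑ i, g (u i) x ^ 2 := by
  conv_lhs => enter [1]; rw [hu.eq_sum x]
  simp [sq]

end IsOrthonormalBasis

/-! ### Powers of an orthogonal matrix -/

section Matrices

variable {ι : Type*} [Fintype ι] [DecidableEq ι]

/-- All entries of `D, D ^ 2, …, D ^ q` have absolute value `1 / q`. -/
def HasFlatPowers (q : ℕ) (D : Matrix ι ι ℝ) : Prop :=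
  ∀ k ∈ Set.Icc 1 q, ∀ i j, (D ^ k) i j ^ 2 = 1 / (q : ℝ) ^ 2

open Matrix in
theorem dotProduct_col_pow_of_le {D : Matrix ι ι ℝ} (hD : D ∈ orthogonalGroup ι ℝ) {j k : ℕ}
    (hjk : j ≤ k) (i l : ι) :
    dotProductBilin ℝ ℝ ((D ^ j).col i) ((D ^ k).col l) = (D ^ (k - j)) i l := by
  have h1 : (D ^ j)ᵀ * D ^ j = 1 := (mem_orthogonalGroup_iff' ι ℝ).1 (pow_mem hD j)
  have h2 : (D ^ j)ᵀ * D ^ k = D ^ (k - j) := by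
    rw [← Nat.add_sub_cancel' hjk, pow_add, ← mul_assoc, h1, one_mul, Nat.add_sub_cancel_left]
  rw [← h2]
  rfl

variable {q : ℕ} {D : Matrix ι ι ℝ}

theorem HasFlatPowers.pow_ne_one (hq : 2 ≤ q) (hcard : Fintype.card ι = q ^ 2)
    (h : HasFlatPowers q D) {k : ℕ} (hk : k ∈ Set.Icc 1 q) : D ^ k ≠ 1 := by
  intro h1
  have : 1 < Fintype.card ι := by rw [hcard]; nlinarith
  obtain ⟨i, j, hij⟩ := Fintype.one_lt_card_iff.1 this
  have h2 := h k hk i j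
  rw [h1, Matrix.one_apply_ne hij] at h2
  have h3 : (0 : ℝ) < 1 / (q : ℝ) ^ 2 := by positivity
  simp [← h2] at h3

theorem HasFlatPowers.orderOf_eq (hq : 2 ≤ q) (hcard : Fintype.card ι = q ^ 2)
    (h : HasFlatPowers q D) (hpow : D ^ (q + 1) = 1) : orderOf D = q + 1 :=
  (orderOf_eq_iff q.succ_pos).2
    ⟨hpow, fun _ hm hm0 => h.pow_ne_one hq hcard ⟨hm0, Nat.lt_succ_iff.1 hm⟩⟩

theorem powersMutuallyUnbiased_iff_hasFlatPowers (hcard : Fintype.card ι = q ^ 2)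
    (hD : D ∈ Matrix.orthogonalGroup ι ℝ) (hpow : D ^ (q + 1) = 1) :
    PowersMutuallyUnbiased q D ↔ HasFlatPowers q D := by
  have hcard' : (Fintype.card ι : ℝ) = (q : ℝ) ^ 2 := by exact_mod_cast hcard
  constructor
  · intro h k hk i j
    -- compare the columns of `D ^ k` with the standard basis, the columns of `D ^ (q + 1) = 1`
    have h1 := (h (q + 1) ⟨by omega, le_rfl⟩ k ⟨hk.1, hk.2.trans q.le_succ⟩
      (by have := hk.2; omega)).unbiased i j
    have h2 := dotProduct_col_pow_of_le hD (Nat.zero_le k) i j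
    rw [pow_zero, ← hpow, Nat.sub_zero] at h2
    rw [← h2, h1, hcard']
  · intro h
    have hon : ∀ j, IsOrthonormalBasis (dotProductBilin ℝ ℝ : LinearMap.BilinForm ℝ (ι → ℝ))
        (fun i => (D ^ j).col i) := fun j => by
      refine .of_card_eq_finrank (fun i l => ?_) (by simp)
      rw [dotProduct_col_pow_of_le hD le_rfl, Nat.sub_self, pow_zero, Matrix.one_apply]
    intro j hj k hk hjk
    refine ⟨hon j, hon k, fun i l => ?_⟩
    rw [hcard']
    rcases lt_or_gt_of_ne hjk with hlt | hlt
    · rw [dotProduct_col_pow_of_le hD hlt.le]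
      exact h _ ⟨by omega, by have := hj.1; have := hk.2; omega⟩ i l
    · rw [show dotProductBilin ℝ ℝ ((D ^ j).col i) ((D ^ k).col l)
        = dotProductBilin ℝ ℝ ((D ^ k).col l) ((D ^ j).col i) from dotProduct_comm _ _,
        dotProduct_col_pow_of_le hD hlt.le]
      exact h _ ⟨by omega, by have := hk.1; have := hj.2; omega⟩ l i

theorem powersHadamard_iff_hasFlatPowers (hq : 2 ≤ q) (hcard : Fintype.card ι = q ^ 2)
    (hD : D ∈ Matrix.orthogonalGroup ι ℝ) :
    PowersHadamard q D ↔ HasFlatPowers q D := by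
  have hq0 : (q : ℝ) ≠ 0 := by positivity
  have hcard' : (Fintype.card ι : ℝ) = (q : ℝ) ^ 2 := by exact_mod_cast hcard
  have hentry : ∀ x : ℝ, (q : ℝ) * x * (q * x) = 1 ↔ x ^ 2 = 1 / (q : ℝ) ^ 2 := fun x => by
    rw [eq_div_iff (by positivity)]
    constructor <;> intro h <;> linarith
  constructor
  · intro h k hk i j
    have := Unitary.mul_star_self_of_mem ((h.1 k hk).apply_mem i j)
    exact (hentry _).1 (by simpa using this)
  · intro h
    refine ⟨fun k hk => ⟨fun i j => ?_, ?_, ?_⟩, ?_⟩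
    · have := (hentry _).2 (h k hk i j)
      rw [Unitary.mem_iff]
      simpa using this
    · have := (Matrix.mem_orthogonalGroup_iff ι ℝ).1 (pow_mem hD k)
      rw [Matrix.conjTranspose_eq_transpose_of_trivial, Matrix.transpose_smul, smul_mul_smul_comm,
        this, hcard', sq]
    · have := (Matrix.mem_orthogonalGroup_iff' ι ℝ).1 (pow_mem hD k)
      rw [Matrix.conjTranspose_eq_transpose_of_trivial, Matrix.transpose_smul, smul_mul_smul_comm,
        this, hcard', sq]
    · have key : ∀ j ∈ Set.Icc 1 q, ∀ k ∈ Set.Icc 1 q, j < k → D ^ j ≠ D ^ k := by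
        intro j hj k hk hlt he
        refine h.pow_ne_one hq hcard (k := k - j) ⟨by omega, by have := hk.2; omega⟩ ?_
        have h1 := (Matrix.mem_orthogonalGroup_iff' ι ℝ).1 (pow_mem hD j)
        have h2 : D ^ j * D ^ (k - j) = D ^ j := by
          rw [← pow_add, Nat.add_sub_cancel' hlt.le, he]
        rw [← one_mul (D ^ (k - j)), ← h1, mul_assoc, h2]
      intro j hj k hk he
      have he' : D ^ j = D ^ k := smul_right_injective _ hq0 he
      rcases lt_trichotomy j k with hlt | heq | hlt
      · exact (key j hj k hk hlt he').elim
      · exact heq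
      · exact (key k hk j hj hlt he'.symm).elim

end Matrices

/-! ### Hermitian planes in characteristic two -/

section HermitianPlane

variable {K V : Type*} [Field K] [CharP K 2] [AddCommGroup V] [Module K V] {r q : ℕ}
  {f : V →ₗ[K] V →ₛₗ[iterateFrobenius K 2 r] K}

omit [Field K] [CharP K 2] in
theorem finite_of_card_eq_sq (hq : 2 ≤ q) (hK : Nat.card K = q ^ 2) : Finite K :=
  Nat.finite_of_card_ne_zero (by rw [hK]; positivity)

omit [CharP K 2] in
theorem exists_orderOf_eq_add_one (hq : 2 ≤ q) (hK : Nat.card K = q ^ 2) :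
    ∃ c : K, orderOf c = q + 1 := by
  have := finite_of_card_eq_sq hq hK
  obtain ⟨g, hg⟩ := IsCyclic.exists_ofOrder_eq_natCard (α := Kˣ)
  obtain ⟨m, rfl⟩ : ∃ m, q = m + 1 := ⟨q - 1, by omega⟩
  have hcard : Nat.card Kˣ = m * (m + 1 + 1) := by
    rw [Nat.card_units, hK]
    exact Nat.sub_eq_of_eq_add (by ring)
  -- the group `Kˣ` is cyclic of order `(q - 1) (q + 1)`, and `m = q - 1`
  refine ⟨((g ^ m : Kˣ) : K), ?_⟩
  rw [orderOf_units, orderOf_pow_of_dvd (by omega) (by rw [hg, hcard]; exact dvd_mul_right _ _),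
    hg, hcard, Nat.mul_div_cancel_left _ (by omega)]

/-- The trace of `K` to its subfield with `q` elements is not zero. -/
theorem exists_add_pow_ne_zero (hq : 2 ≤ q) (hK : Nat.card K = q ^ 2) :
    ∃ t : K, t + t ^ q ≠ 0 := by
  obtain ⟨c, hc⟩ := exists_orderOf_eq_add_one hq hK
  refine ⟨c, fun h => ?_⟩
  have hc0 : c ≠ 0 := by
    rintro rfl
    simp at hc
  rw [CharTwo.add_eq_zero] at h
  have h1 : c ^ (q - 1) = 1 := by
    apply mul_left_cancel₀ hc0
    rw [mul_one, ← pow_succ', Nat.sub_add_cancel (by omega), ← h]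
  have h2 := Nat.le_of_dvd (by omega) (hc ▸ orderOf_dvd_of_pow_eq_one h1)
  omega

theorem eq_of_add_eq_zero_of_charTwo (K : Type*) {V : Type*} [Field K] [CharP K 2] [AddCommGroup V]
    [Module K V] {u v : V} (h : u + v = 0) : u = v := by
  rw [eq_neg_of_add_eq_zero_left h, ← neg_one_smul K v, CharTwo.neg_eq, one_smul]

theorem hermitian_smul_right (hq : q = 2 ^ r) (u v : V) (c : K) :
    f u (c • v) = c ^ q * f u v := by
  rw [LinearMap.map_smulₛₗ, iterateFrobenius_def, hq, smul_eq_mul]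

namespace IsNondegenerateHermitian

variable (hf : IsNondegenerateHermitian q f)
include hf

/-- Some vector is not isotropic: otherwise polarization would make the trace of `K` to its
subfield with `q` elements vanish on every value of `f`. -/
theorem exists_apply_self_ne_zero (hq2 : 2 ≤ q) (hK : Nat.card K = q ^ 2) [Nontrivial V] :
    ∃ u, f u u ≠ 0 := by
  by_contra! h
  obtain ⟨t, ht⟩ := exists_add_pow_ne_zero hq2 hK
  obtain ⟨u, hu⟩ := exists_ne (0 : V)
  obtain ⟨w, hw⟩ : ∃ w, f u w ≠ 0 := by
    by_contra! h'
    exact hu (hf.nondegenerate u h')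
  have hv : f ((t / f u w) • u) w = t := by
    rw [map_smul, LinearMap.smul_apply, smul_eq_mul, div_mul_cancel₀ _ hw]
  have h2 := h ((t / f u w) • u + w)
  rw [map_add, map_add, LinearMap.add_apply, LinearMap.add_apply, h, h, zero_add, add_zero,
    hv, hf.hermitian _ w, hv, add_comm] at h2
  exact ht h2

/-- A vector that is not isotropic has a multiple `v` with `f v v = 1`, because every element of
the subfield with `q` elements is a square in it. -/
theorem exists_smul_apply_self_eq_one (hr : 1 ≤ r) (hq : q = 2 ^ r) {u : V} (hu : f u u ≠ 0) :
    ∃ c : K, f (c • u) (c • u) = 1 := by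
  set a := f u u with ha
  have haq : a ^ q = a := (hf.hermitian u u).symm
  -- the square root of `a` is `a ^ (q / 2)`
  set s := a ^ 2 ^ (r - 1) with hs
  have hs0 : s ≠ 0 := pow_ne_zero _ hu
  have hs2 : s * s = a := by
    rw [hs, ← pow_add, ← two_mul, ← pow_succ', Nat.sub_add_cancel hr, ← hq, haq]
  have hsq : s ^ q = s := by rw [hs, pow_right_comm, haq]
  refine ⟨s⁻¹, ?_⟩
  rw [hermitian_smul_right hq, map_smul, LinearMap.smul_apply, ← ha, inv_pow, hsq, ← hs2,
    smul_eq_mul]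
  field_simp

theorem exists_orthonormal (hr : 1 ≤ r) (hq : q = 2 ^ r) (hK : Nat.card K = q ^ 2)
    (hV : Module.finrank K V = 2) :
    ∃ u₁ u₂, f u₁ u₁ = 1 ∧ f u₂ u₂ = 1 ∧ f u₁ u₂ = 0 := by
  have hq2 : 2 ≤ q := by rw [hq]; exact Nat.le_self_pow (by omega) 2
  have : Nontrivial V := Module.nontrivial_of_finrank_pos (R := K) (by omega)
  have : FiniteDimensional K V := Module.finite_of_finrank_pos (by omega)
  obtain ⟨u, hu⟩ := hf.exists_apply_self_ne_zero hq2 hK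
  obtain ⟨u₁, h11⟩ : ∃ u₁, f u₁ u₁ = 1 :=
    let ⟨c, h⟩ := hf.exists_smul_apply_self_eq_one hr hq hu
    ⟨c • u, h⟩
  -- the second vector spans the orthogonal complement of `u₁`, which is the kernel of `l`
  let l : V →ₗ[K] K := f.flip u₁
  have hl : ∀ v, l v = f v u₁ := fun v => rfl
  have hker : Module.finrank K (LinearMap.ker l) = 1 := by
    have h1 := l.finrank_range_add_finrank_ker
    have h2 : LinearMap.range l = ⊤ := by
      refine LinearMap.range_eq_top.2 (LinearMap.surjective fun h0 => ?_)
      have := congrArg (fun m => m u₁) h0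
      simp [hl, h11] at this
    rw [h2, finrank_top, Module.finrank_self, hV] at h1
    omega
  obtain ⟨⟨y, hy⟩, hy0⟩ := (Module.finrank_pos_iff_exists_ne_zero (R := K)).1 (hker.symm ▸ one_pos)
  have hy1 : f y u₁ = 0 := hy
  have hyy : f y y ≠ 0 := by
    intro h0
    apply hy0
    rw [Subtype.ext_iff]
    refine hf.nondegenerate y fun w => ?_
    obtain ⟨d, hd⟩ := (finrank_eq_one_iff_of_nonzero' _ hy0).1 hker
      ⟨w - f w u₁ • u₁, by simp [hl, h11]⟩
    have hw : w = f w u₁ • u₁ + d • y := by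
      rw [show d • y = w - f w u₁ • u₁ from congrArg Subtype.val hd]
      abel
    rw [hw, map_add, hermitian_smul_right hq, hermitian_smul_right hq, hy1, h0]
    simp
  obtain ⟨d, h22⟩ := hf.exists_smul_apply_self_eq_one hr hq hyy
  refine ⟨u₁, d • y, h11, h22, ?_⟩
  have hq0 : q ≠ 0 := by omega
  rw [hermitian_smul_right hq, hf.hermitian y u₁, hy1, zero_pow hq0, mul_zero]

theorem apply_comm_of_eq_zero (hq0 : q ≠ 0) {u v : V} (h : f u v = 0) : f v u = 0 := by
  rw [hf.hermitian u v, h, zero_pow hq0]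

theorem eq_smul_add_smul (hq : q = 2 ^ r) (hV : Module.finrank K V = 2)
    {u₁ u₂ : V} (h11 : f u₁ u₁ = 1) (h22 : f u₂ u₂ = 1) (h12 : f u₁ u₂ = 0) :
    LinearIndependent K ![u₁, u₂] ∧ ∀ v, v = f v u₁ • u₁ + f v u₂ • u₂ := by
  have hq0 : q ≠ 0 := by rw [hq]; positivity
  have h21 := hf.apply_comm_of_eq_zero hq0 h12
  have hli : LinearIndependent K ![u₁, u₂] := by
    rw [LinearIndependent.pair_iff]
    intro s t hst
    have e1 := congrArg (fun x => f x u₁) hst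
    have e2 := congrArg (fun x => f x u₂) hst
    simp [h11, h21] at e1
    simp [h12, h22] at e2
    exact ⟨e1, e2⟩
  refine ⟨hli, fun v => ?_⟩
  have : FiniteDimensional K V := Module.finite_of_finrank_pos (by omega)
  have hspan := hli.span_eq_top_of_card_eq_finrank' (by simp [hV])
  have hv : v ∈ Submodule.span K (Set.range ![u₁, u₂]) := hspan ▸ Submodule.mem_top
  rw [Matrix.range_cons, Matrix.range_cons, Matrix.range_empty, Set.union_empty,
    Set.singleton_union, Submodule.mem_span_pair] at hv
  obtain ⟨a, b, rfl⟩ := hv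
  simp [h11, h12, h21, h22]

theorem exists_isIsotropicLine (hr : 1 ≤ r) (hq : q = 2 ^ r) (hK : Nat.card K = q ^ 2)
    (hV : Module.finrank K V = 2) : ∃ U : Submodule K V, IsIsotropicLine f U := by
  obtain ⟨u₁, u₂, h11, h22, h12⟩ := hf.exists_orthonormal hr hq hK hV
  have hq0 : q ≠ 0 := by rw [hq]; positivity
  have h21 := hf.apply_comm_of_eq_zero hq0 h12
  refine ⟨Submodule.span K {u₁ + u₂}, finrank_span_singleton fun h0 => ?_, fun u hu v hv => ?_⟩
  · have := congrArg (fun x => f x u₁) h0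
    simp [h11, h21] at this
  · obtain ⟨a, rfl⟩ := Submodule.mem_span_singleton.1 hu
    obtain ⟨b, rfl⟩ := Submodule.mem_span_singleton.1 hv
    rw [hermitian_smul_right hq]
    simp [h11, h12, h21, h22, CharTwo.add_self_eq_zero]

theorem exists_isDiagonalIsometry (hr : 1 ≤ r) (hq : q = 2 ^ r) (hK : Nat.card K = q ^ 2)
    (hV : Module.finrank K V = 2) : ∃ σ : isometryGroup f, IsDiagonalIsometry q f σ := by
  have hq2 : 2 ≤ q := by rw [hq]; exact Nat.le_self_pow (by omega) 2
  obtain ⟨u₁, u₂, h11, h22, h12⟩ := hf.exists_orthonormal hr hq hK hV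
  have h21 := hf.apply_comm_of_eq_zero (by omega) h12
  obtain ⟨c, hc⟩ := exists_orderOf_eq_add_one hq2 hK
  have hc1 : c ^ q * c = 1 := by rw [← pow_succ, ← hc, pow_orderOf_eq_one]
  have hc0 : c ≠ 0 := right_ne_zero_of_mul_eq_one hc1
  have : FiniteDimensional K V := Module.finite_of_finrank_pos (by omega)
  obtain ⟨hli, hspan⟩ := hf.eq_smul_add_smul hq hV h11 h22 h12
  let b : Module.Basis (Fin 2) K V := basisOfLinearIndependentOfCardEqFinrank hli (by simp [hV])
  have hb : (b : Fin 2 → V) = ![u₁, u₂] := coe_basisOfLinearIndependentOfCardEqFinrank _ _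
  let σ : V ≃ₗ[K] V := b.equiv (b.unitsSMul ![Units.mk0 c hc0, 1]) (Equiv.refl _)
  have hσ1 : σ u₁ = c • u₁ := by
    have := b.equiv_apply 0 (b.unitsSMul ![Units.mk0 c hc0, 1]) (Equiv.refl _)
    simpa [hb, Module.Basis.unitsSMul_apply, Units.smul_def] using this
  have hσ2 : σ u₂ = u₂ := by
    have := b.equiv_apply 1 (b.unitsSMul ![Units.mk0 c hc0, 1]) (Equiv.refl _)
    simpa [hb, Module.Basis.unitsSMul_apply, Units.smul_def] using this
  have hσ : ∀ u v, f (σ u) (σ v) = f u v := by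
    intro u v
    rw [hspan u, hspan v]
    simp only [map_add, map_smul, hσ1, hσ2, LinearMap.add_apply, LinearMap.smul_apply,
      hermitian_smul_right hq, h11, h12, h21, h22, smul_eq_mul]
    linear_combination f u u₁ * (f v u₁) ^ q * hc1
  exact ⟨⟨σ, hσ⟩, u₁, u₂, c, h11, h22, h12, hc, hσ1, hσ2⟩

end IsNondegenerateHermitian

theorem isometryGroup_coe_pow_succ_apply (σ : isometryGroup f) (n : ℕ) (v : V) :
    (σ ^ (n + 1)).1 v = σ.1 ((σ ^ n).1 v) := by
  rw [pow_succ']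
  rfl

namespace IsDiagonalIsometry

variable {σ : isometryGroup f}

theorem exists_pow_apply (hσ : IsDiagonalIsometry q f σ) :
    ∃ (u₁ u₂ : V) (c : K), f u₁ u₁ = 1 ∧ f u₂ u₂ = 1 ∧ f u₁ u₂ = 0 ∧ orderOf c = q + 1 ∧
      ∀ n, (σ ^ n).1 u₁ = c ^ n • u₁ ∧ (σ ^ n).1 u₂ = u₂ := by
  obtain ⟨u₁, u₂, c, h11, h22, h12, hc, h1, h2⟩ := hσ
  refine ⟨u₁, u₂, c, h11, h22, h12, hc, fun n => ?_⟩
  induction n with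
  | zero => simp
  | succ n ih =>
    rw [isometryGroup_coe_pow_succ_apply, isometryGroup_coe_pow_succ_apply, ih.1, ih.2, map_smul,
      h1, h2, smul_smul, pow_succ]
    exact ⟨rfl, rfl⟩

variable (hf : IsNondegenerateHermitian q f) (hq : q = 2 ^ r) (hV : Module.finrank K V = 2)
  (hσ : IsDiagonalIsometry q f σ)
include hf hq hV hσ

theorem orderOf_eq : orderOf σ = q + 1 := by
  obtain ⟨u₁, u₂, c, h11, h22, h12, hc, h⟩ := hσ.exists_pow_apply
  obtain ⟨-, hspan⟩ := hf.eq_smul_add_smul hq hV h11 h22 h12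
  rw [← hc]
  refine orderOf_eq_orderOf_iff.2 fun n => ⟨fun hn => ?_, fun hn => ?_⟩
  · have h1 := (h n).1
    rw [hn] at h1
    have h2 := congrArg (fun x => f x u₁) h1
    simpa [h11] using h2.symm
  · refine Subtype.ext (LinearEquiv.ext fun v => ?_)
    rw [hspan v, map_add, map_smul, map_smul, (h n).1, (h n).2, hn, one_smul]
    rfl

/-- A nontrivial power of `σ` moves every isotropic line to a different one: with
`u = a u₁ + b u₂`, both `N a + N b` and `c ^ m N a + N b` vanish. -/
theorem eq_zero_of_pow_apply_mem {U : Submodule K V} (hU : IsIsotropicLine f U) {m : ℕ}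
    (hm : m ∈ Set.Icc 1 q) {u : V} (hu : u ∈ U) (hmu : (σ ^ m).1 u ∈ U) : u = 0 := by
  obtain ⟨u₁, u₂, c, h11, h22, h12, hc, h⟩ := hσ.exists_pow_apply
  obtain ⟨-, hspan⟩ := hf.eq_smul_add_smul hq hV h11 h22 h12
  have hq0 : q ≠ 0 := by rw [hq]; positivity
  have h21 := hf.apply_comm_of_eq_zero hq0 h12
  have e1 := hU.2 u hu u hu
  have e2 := hU.2 _ hmu u hu
  have hcm : c ^ m ≠ 1 := pow_ne_one_of_lt_orderOf (by have := hm.1; omega)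
    (by have := hm.2; omega)
  set a := f u u₁
  set b := f u u₂
  have hu' : u = a • u₁ + b • u₂ := hspan u
  rw [hu'] at e1 e2
  simp only [map_add, map_smul, (h m).1, (h m).2, LinearMap.add_apply, LinearMap.smul_apply,
    hermitian_smul_right hq, h11, h12, h21, h22, smul_eq_mul] at e1 e2
  have h3 : (c ^ m - 1) * (a * a ^ q) = 0 := by linear_combination e2 - e1
  have ha : a = 0 := by
    have := (mul_eq_zero.1 h3).resolve_left (sub_ne_zero.2 hcm)
    simpa [hq0] using this
  have hb : b = 0 := by
    have : b * b ^ q = 0 := by simpa [ha, hq0] using e1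
    simpa [hq0] using this
  rw [hu', ha, hb, zero_smul, zero_smul, add_zero]

end IsDiagonalIsometry

theorem IsIsotropicLine.map {U : Submodule K V} (hU : IsIsotropicLine f U)
    (σ : isometryGroup f) : IsIsotropicLine f (U.map σ.1.toLinearMap) := by
  refine ⟨(LinearEquiv.finrank_map_eq σ.1 U).trans hU.1, ?_⟩
  rintro _ ⟨u, hu, rfl⟩ _ ⟨v, hv, rfl⟩
  exact (σ.2 u v).trans (hU.2 u hu v hv)

omit [CharP K 2] in
theorem isCompl_of_disjoint_of_finrank (hV : Module.finrank K V = 2) {U W : Submodule K V}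
    (hU : Module.finrank K U = 1) (hW : Module.finrank K W = 1) (h : U ⊓ W = ⊥) :
    IsCompl U W := by
  have : FiniteDimensional K V := Module.finite_of_finrank_pos (by omega)
  refine ⟨disjoint_iff.2 h, codisjoint_iff.2 (Submodule.eq_top_of_finrank_eq ?_)⟩
  have := Submodule.finrank_sup_add_finrank_inf_eq U W
  rw [h, finrank_bot] at this
  omega

theorem IsIsotropicLine.isCompl_map_pow (hf : IsNondegenerateHermitian q f) (hq : q = 2 ^ r)
    (hV : Module.finrank K V = 2) {σ : isometryGroup f} (hσ : IsDiagonalIsometry q f σ)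
    {U : Submodule K V} (hU : IsIsotropicLine f U) {m : ℕ} (hm : m ∈ Set.Icc 1 q) :
    IsCompl U (U.map (σ ^ m).1.toLinearMap) := by
  refine isCompl_of_disjoint_of_finrank hV hU.1 (hU.map (σ ^ m)).1 (eq_bot_iff.2 ?_)
  rintro x ⟨hx, u, hu, rfl⟩
  rw [hσ.eq_zero_of_pow_apply_mem hf hq hV hU hm hu hx]
  simp

/-- An isotropic line of a plane is its own orthogonal complement, so a vector outside it pairs
with the line onto all of `K`. -/
theorem IsIsotropicLine.exists_apply_eq (hf : IsNondegenerateHermitian q f)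
    (hV : Module.finrank K V = 2) {U : Submodule K V}
    (hU : IsIsotropicLine f U) {x : V} (hx : x ∉ U) (t : K) : ∃ u ∈ U, f u x = t := by
  have : FiniteDimensional K U := Module.finite_of_finrank_pos (hU.1.symm ▸ one_pos)
  obtain ⟨⟨u, huU⟩, hu⟩ := (Module.finrank_pos_iff_exists_ne_zero (R := K)).1 (hU.1.symm ▸ one_pos)
  have hu0 : u ≠ 0 := fun h => hu (Subtype.ext h)
  have hx0 : x ≠ 0 := fun h => hx (h ▸ U.zero_mem)
  have hcompl : IsCompl U (Submodule.span K {x}) := by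
    refine isCompl_of_disjoint_of_finrank hV hU.1 (finrank_span_singleton hx0)
      (disjoint_iff.1 ?_)
    rwa [Submodule.disjoint_span_singleton' hx0]
  have hux : f u x ≠ 0 := by
    intro h0
    refine hu0 (hf.nondegenerate u fun w => ?_)
    have hw : w ∈ U ⊔ Submodule.span K {x} := hcompl.sup_eq_top ▸ Submodule.mem_top
    obtain ⟨y, hy, z, hz, rfl⟩ := Submodule.mem_sup.1 hw
    obtain ⟨a, rfl⟩ := Submodule.mem_span_singleton.1 hz
    rw [map_add, hU.2 u huU y hy, LinearMap.map_smulₛₗ, h0, smul_zero, add_zero]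
  refine ⟨(t / f u x) • u, U.smul_mem _ huU, ?_⟩
  rw [map_smul, LinearMap.smul_apply, smul_eq_mul, div_mul_cancel₀ _ hux]

omit [CharP K 2] in
theorem natCard_of_finrank_eq_one {U : Submodule K V} (hK : Nat.card K = q ^ 2)
    (hU : Module.finrank K U = 1) : Nat.card U = q ^ 2 := by
  have : FiniteDimensional K U := Module.finite_of_finrank_pos (by omega)
  rw [← hK]
  exact Nat.card_congr
    (LinearEquiv.ofFinrankEq U K (by rw [hU, Module.finrank_self])).toEquiv

end HermitianPlane

/-! ### Representations of the group with a given central character -/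

section CentralCharacter

variable {K V : Type*} [Field K] [CharP K 2] [AddCommGroup V] [Module K V] {r q : ℕ}
  {f : V →ₗ[K] V →ₛₗ[iterateFrobenius K 2 r] K}
  {k E : Type*} [Field k] [AddCommGroup E] [Module k E]

/-- The elements `(0, a)` of the center act through the character `ψ`. -/
def HasCentralCharacter (X : Representation k (HermitianGroup f) E) (ψ : AddChar K k) : Prop :=
  ∀ a, X ⟨0, a⟩ = ψ a • 1

/-- The character `ψ` of `K` is nontrivial on the subfield with `q` elements, which consists of the
traces `t + t ^ q`; equivalently, it is nontrivial on the commutator subgroup of the group. -/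
def IsNontrivialOnTraces (q : ℕ) (ψ : AddChar K k) : Prop :=
  ∃ t, ψ (t + t ^ q) ≠ 1

theorem AddChar.mul_self_of_charTwo (ψ : AddChar K k) (a : K) : ψ a * ψ a = 1 := by
  rw [← ψ.map_add_eq_mul, CharTwo.add_self_eq_zero, ψ.map_zero_eq_one]

theorem AddChar.eq_one_or_eq_neg_one_of_charTwo (ψ : AddChar K k) (a : K) :
    ψ a = 1 ∨ ψ a = -1 :=
  mul_self_eq_one_iff.1 (ψ.mul_self_of_charTwo a)

/-- The commutator pairing is non-degenerate. -/
theorem IsNontrivialOnTraces.exists_apply_ne_one {ψ : AddChar K k}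
    (hψ : IsNontrivialOnTraces q ψ) (hf : IsNondegenerateHermitian q f) [Finite K] {u : V}
    (hu : u ≠ 0) : ∃ w, ψ (f u w + f w u) ≠ 1 := by
  obtain ⟨t, ht⟩ := hψ
  obtain ⟨w, hw⟩ : ∃ w, f u w ≠ 0 := by
    by_contra! h
    exact hu (hf.nondegenerate u h)
  -- `f` is semilinear in the second variable, and the Frobenius map of a finite field is onto
  obtain ⟨c, hc⟩ := Finite.surjective_of_injective (iterateFrobenius K 2 r).injective (t / f u w)
  refine ⟨c • w, ?_⟩
  have h : f u (c • w) = t := by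
    rw [LinearMap.map_smulₛₗ, hc, smul_eq_mul, div_mul_cancel₀ _ hw]
  rwa [hf.hermitian u (c • w), h]

namespace HasCentralCharacter

variable {X : Representation k (HermitianGroup f) E} {ψ : AddChar K k}

theorem apply_eq (hX : HasCentralCharacter X ψ) (v : V) (a : K) :
    X ⟨v, a⟩ = ψ a • X ⟨v, 0⟩ := by
  have : (⟨v, a⟩ : HermitianGroup f) = ⟨0, a⟩ * ⟨v, 0⟩ := by
    apply HermitianGroup.ext
    · exact (zero_add v).symm
    · change a = f 0 v + a + 0
      simp
  rw [this, map_mul, hX, smul_mul_assoc, one_mul]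

theorem apply_zero (hX : HasCentralCharacter X ψ) : X ⟨0, 0⟩ = 1 := by
  rw [hX, ψ.map_zero_eq_one, one_smul]

theorem mul (hX : HasCentralCharacter X ψ) (u v : V) :
    X ⟨u, 0⟩ * X ⟨v, 0⟩ = ψ (f u v) • X ⟨u + v, 0⟩ := by
  rw [← hX.apply_eq, ← map_mul]
  congr 1
  apply HermitianGroup.ext
  · rfl
  · change f u v + 0 + 0 = f u v
    simp

theorem mul_comm (hX : HasCentralCharacter X ψ) (u v : V) :
    X ⟨u, 0⟩ * X ⟨v, 0⟩ = ψ (f u v + f v u) • (X ⟨v, 0⟩ * X ⟨u, 0⟩) := by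
  rw [hX.mul, hX.mul, smul_smul, add_comm v u, ← ψ.map_add_eq_mul, add_assoc,
    CharTwo.add_self_eq_zero, add_zero]

theorem comp_isometryHat (hX : HasCentralCharacter X ψ) (σ : isometryGroup f) :
    HasCentralCharacter (X.comp (isometryHat f σ).toMonoidHom) ψ := by
  intro a
  rw [← hX a]
  change X ⟨σ.1 0, a⟩ = _
  rw [map_zero]

section Nontrivial

variable [Finite K] (hf : IsNondegenerateHermitian q f) (hψ : IsNontrivialOnTraces q ψ)
include hf hψ

theorem trace_eq_zero (hX : HasCentralCharacter X ψ) {u : V} (hu : u ≠ 0) :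
    LinearMap.trace k E (X ⟨u, 0⟩) = 0 := by
  obtain ⟨w, hw⟩ := hψ.exists_apply_ne_one hf hu
  have h1 : X ⟨w, 0⟩ * X (⟨w, 0⟩⁻¹) = 1 := by rw [← map_mul, mul_inv_cancel, map_one]
  have h2 : X (⟨w, 0⟩⁻¹) * X ⟨w, 0⟩ = 1 := by rw [← map_mul, inv_mul_cancel, map_one]
  have h3 : X ⟨u, 0⟩ = ψ (f u w + f w u) • (X ⟨w, 0⟩ * X ⟨u, 0⟩ * X (⟨w, 0⟩⁻¹)) := by
    rw [← smul_mul_assoc, ← hX.mul_comm, mul_assoc, h1, mul_one]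
  have h4 := congrArg (LinearMap.trace k E) h3
  rw [map_smul, LinearMap.trace_mul_comm, ← mul_assoc, h2, one_mul, smul_eq_mul] at h4
  have h5 : (ψ (f u w + f w u) - 1) * LinearMap.trace k E (X ⟨u, 0⟩) = 0 := by
    linear_combination -h4
  exact (mul_eq_zero.1 h5).resolve_left (sub_ne_zero.2 hw)

variable [FiniteDimensional k E]

open scoped Classical in
theorem character_eq (hX : HasCentralCharacter X ψ) (x : HermitianGroup f) :
    X.character x = if x.vec = 0 then ψ x.scal * Module.finrank k E else 0 := by
  obtain ⟨v, a⟩ := x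
  rw [Representation.character, hX.apply_eq, map_smul, smul_eq_mul]
  split_ifs with h
  · obtain rfl : v = 0 := h
    rw [hX.apply_zero, LinearMap.trace_one]
  · rw [hX.trace_eq_zero hf hψ h, mul_zero]

variable [CharZero k] (hK : Nat.card K = q ^ 2) (hV : Module.finrank K V = 2)
  (hE : Module.finrank k E = q ^ 2)
include hK hE

/-- The operators `X (v, 0)` are orthogonal to each other for the trace form. -/
theorem linearIndependent [Finite V] (hX : HasCentralCharacter X ψ) :
    LinearIndependent k (fun v : V => X ⟨v, 0⟩) := by
  have := Fintype.ofFinite V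
  have hq0 : (q : k) ≠ 0 := by
    have : 0 < Nat.card K := Nat.card_pos
    rw [hK] at this
    exact Nat.cast_ne_zero.2 (by rintro rfl; simp at this)
  rw [Fintype.linearIndependent_iff]
  intro c hc w
  have h1 := congrArg (fun A => LinearMap.trace k E (A * X ⟨w, 0⟩)) hc
  simp only [Finset.sum_mul, smul_mul_assoc, map_sum, map_smul, zero_mul, map_zero, hX.mul] at h1
  rw [Finset.sum_eq_single w] at h1
  · have h2 : w + w = 0 := by rw [← two_smul K w, CharTwo.two_eq_zero, zero_smul]
    rw [h2, hX.apply_zero, LinearMap.trace_one, hE] at h1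
    have h3 : ψ (f w w) ≠ 0 := left_ne_zero_of_mul_eq_one (ψ.mul_self_of_charTwo _)
    simpa [h3, hq0] using h1
  · intro v _ hv
    rw [hX.trace_eq_zero hf hψ, smul_zero, smul_zero]
    intro h
    exact hv (eq_of_add_eq_zero_of_charTwo K h)
  · simp

include hV

theorem exists_basis (hX : HasCentralCharacter X ψ) :
    ∃ b : Module.Basis V k (Module.End k E), ∀ v, b v = X ⟨v, 0⟩ := by
  have : FiniteDimensional K V := Module.finite_of_finrank_pos (by omega)
  have : Finite V := Module.finite_of_finite K
  have := Fintype.ofFinite V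
  have hcard : Fintype.card V = Module.finrank k (Module.End k E) := by
    rw [Module.finrank_linearMap, hE, ← hK, ← Nat.card_eq_fintype_card,
      Module.natCard_eq_pow_finrank (K := K), hV, sq]
  exact ⟨basisOfLinearIndependentOfCardEqFinrank (hX.linearIndependent hf hψ hK hE) hcard,
    fun v => by simp⟩

theorem span_eq_top (hX : HasCentralCharacter X ψ) :
    Submodule.span k (Set.range fun v : V => X ⟨v, 0⟩) = ⊤ := by
  obtain ⟨b, hb⟩ := hX.exists_basis hf hψ hK hV hE
  rw [← b.span_eq]
  congr 2
  exact funext fun v => (hb v).symm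

/-- Every operator commuting with the representation is a scalar, over any field of
characteristic zero. -/
theorem exists_eq_smul_of_commute (hX : HasCentralCharacter X ψ) {A : Module.End k E}
    (hA : ∀ v, A * X ⟨v, 0⟩ = X ⟨v, 0⟩ * A) : ∃ c : k, A = c • 1 := by
  have h : A ∈ Set.center (Module.End k E) := by
    rw [Semigroup.mem_center_iff]
    intro M
    have hM : M ∈ Submodule.span k (Set.range fun v : V => X ⟨v, 0⟩) :=
      hX.span_eq_top hf hψ hK hV hE ▸ Submodule.mem_top
    induction hM using Submodule.span_induction with
    | mem M hM => obtain ⟨v, rfl⟩ := hM; exact (hA v).symm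
    | zero => simp
    | add M N _ _ hM hN => rw [add_mul, mul_add, hM, hN]
    | smul c M _ hM => rw [smul_mul_assoc, mul_smul_comm, hM]
  obtain ⟨c, -, rfl⟩ := Module.End.mem_center_iff.1 h
  exact ⟨c, rfl⟩

theorem isIrreducible (hX : HasCentralCharacter X ψ) : X.IsIrreducible := by
  have hpos : 0 < Nat.card K := Nat.card_pos
  have : Nontrivial E := Module.nontrivial_of_finrank_pos (R := k) (by rw [hE, ← hK]; exact hpos)
  have : Nontrivial (Subrepresentation X) := by
    refine ⟨⊥, ⊤, fun h => ?_⟩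
    obtain ⟨e, he⟩ := exists_ne (0 : E)
    have h1 : e ∈ (⊤ : Subrepresentation X).toSubmodule := Submodule.mem_top
    rw [← h] at h1
    exact he h1
  refine ⟨fun N => or_iff_not_imp_left.2 fun hN => ?_⟩
  obtain ⟨e, heN, he⟩ : ∃ e ∈ N.toSubmodule, e ≠ 0 := by
    by_contra! h
    refine hN (Subrepresentation.toSubmodule_injective ?_)
    exact (Submodule.eq_bot_iff _).2 h
  have hinv : ∀ A : Module.End k E, A e ∈ N.toSubmodule := by
    intro A
    have hA : A ∈ Submodule.span k (Set.range fun v : V => X ⟨v, 0⟩) :=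
      hX.span_eq_top hf hψ hK hV hE ▸ Submodule.mem_top
    induction hA using Submodule.span_induction with
    | mem M hM => obtain ⟨v, rfl⟩ := hM; exact N.apply_mem_toSubmodule _ heN
    | zero => exact N.toSubmodule.zero_mem
    | add M M' _ _ hM hM' => exact N.toSubmodule.add_mem hM hM'
    | smul c M _ hM => exact N.toSubmodule.smul_mem c hM
  refine Subrepresentation.toSubmodule_injective ?_
  refine Submodule.eq_top_iff'.2 fun y => ?_
  obtain ⟨l, hl⟩ := Module.Projective.exists_dual_eq_one k he
  have := hinv (l.smulRight y)
  rwa [LinearMap.smulRight_apply, hl, one_smul] at this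

/-- Two representations of dimension `q ^ 2` with the same central character are equivalent: the
bases `X (v, 0)` and `Y (v, 0)` of the endomorphism algebra have the same structure constants, and
every automorphism of that algebra is inner. -/
theorem exists_intertwiner {Y : Representation k (HermitianGroup f) E}
    (hX : HasCentralCharacter X ψ) (hY : HasCentralCharacter Y ψ) :
    ∃ D : E ≃ₗ[k] E, ∀ x e, Y x (D e) = D (X x e) := by
  obtain ⟨b, hb⟩ := hX.exists_basis hf hψ hK hV hE
  obtain ⟨b', hb'⟩ := hY.exists_basis hf hψ hK hV hE
  let Φ : Module.End k E ≃ₗ[k] Module.End k E := b.equiv b' (Equiv.refl V)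
  have hΦ : ∀ v, Φ (X ⟨v, 0⟩) = Y ⟨v, 0⟩ := fun v => by
    rw [← hb, ← hb', b.equiv_apply, Equiv.refl_apply]
  have hmul : ∀ M N, Φ (M * N) = Φ M * Φ N := by
    -- both sides are bilinear, so basis elements suffice
    have h : (LinearMap.mul k (Module.End k E)).compr₂ Φ.toLinearMap
        = (LinearMap.mul k (Module.End k E)).compl₁₂ Φ.toLinearMap Φ.toLinearMap := by
      refine b.ext fun u => b.ext fun v => ?_
      simp [hb, hΦ, hX.mul, hY.mul]
    exact fun M N => LinearMap.congr_fun₂ h M N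
  have hone : Φ 1 = 1 := by simpa [hX.apply_zero, hY.apply_zero] using hΦ 0
  obtain ⟨D, hD⟩ := (AlgEquiv.ofLinearEquiv Φ hone hmul).eq_linearEquivConjAlgEquiv
  refine ⟨D, fun x e => ?_⟩
  obtain ⟨v, a⟩ := x
  have h1 : Φ (X ⟨v, 0⟩) = D.conjAlgEquiv k (X ⟨v, 0⟩) := congrArg (fun m => m (X ⟨v, 0⟩)) hD
  rw [hΦ] at h1
  rw [hX.apply_eq, hY.apply_eq, h1]
  simp [LinearEquiv.conjAlgEquiv_apply]

end Nontrivial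

end HasCentralCharacter

end CentralCharacter

/-! ### Existence of representations and of real forms -/

section Existence

variable {K V : Type*} [Field K] [CharP K 2] [AddCommGroup V] [Module K V] {r q : ℕ}
  {f : V →ₗ[K] V →ₛₗ[iterateFrobenius K 2 r] K}
  {k E : Type*} [Field k] [AddCommGroup E] [Module k E]

/-- If `V = U ⊕ W` with `U` and `W` totally isotropic, the group acts on the functions on `W`: the
elements of `W` act by translation, those of `U` by multiplication with characters. -/
theorem exists_hasCentralCharacter_of_isCompl (ψ : AddChar K k) {U W : Submodule K V}
    (hU : ∀ u ∈ U, ∀ v ∈ U, f u v = 0) (hW : ∀ u ∈ W, ∀ v ∈ W, f u v = 0) (h : IsCompl U W) :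
    ∃ X : Representation k (HermitianGroup f) (W → k), HasCentralCharacter X ψ := by
  let P := U.projectionOnto W h
  let Q := W.projectionOnto U h.symm
  have hPQ : ∀ v, (P v : V) + Q v = v := fun v => Submodule.projection_add_projection_eq_self h v
  have hf : ∀ v v' : V, f v v' = f (P v) (Q v') + f (Q v) (P v') := fun v v' => by
    conv_lhs => rw [← hPQ v, ← hPQ v']
    simp only [map_add, LinearMap.add_apply]
    rw [hU _ (P v).2 _ (P v').2, hW _ (Q v).2 _ (Q v').2]
    ring
  let X : Representation k (HermitianGroup f) (W → k) :=
    { toFun := fun x =>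
        { toFun := fun φ y =>
            ψ (x.scal + f (P x.vec) (Q x.vec) + (f (P x.vec) y + f y (P x.vec))) *
              φ (y + Q x.vec)
          map_add' := fun φ φ' => funext fun y => mul_add _ _ _
          map_smul' := fun c φ => funext fun y => mul_left_comm _ _ _ }
      map_one' := by
        refine LinearMap.ext fun φ => funext fun y => ?_
        change ψ (0 + f (P 0) (Q 0) + (f (P 0) y + f y (P 0))) * φ (y + Q 0) = φ y
        simp
      map_mul' := fun x x' => by
        refine LinearMap.ext fun φ => funext fun y => ?_
        change ψ (f x.vec x'.vec + x.scal + x'.scal + f (P (x.vec + x'.vec)) (Q (x.vec + x'.vec))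
            + (f (P (x.vec + x'.vec)) y + f y (P (x.vec + x'.vec)))) * φ (y + Q (x.vec + x'.vec))
          = ψ (x.scal + f (P x.vec) (Q x.vec) + (f (P x.vec) y + f y (P x.vec))) *
            (ψ (x'.scal + f (P x'.vec) (Q x'.vec) +
              (f (P x'.vec) ((y + Q x.vec : W) : V) + f ((y + Q x.vec : W) : V) (P x'.vec))) *
              φ (y + Q x.vec + Q x'.vec))
        rw [← mul_assoc, ← ψ.map_add_eq_mul, hf x.vec x'.vec, map_add Q, add_assoc y]
        congr 2
        simp only [map_add, Submodule.coe_add, LinearMap.add_apply]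
        linear_combination CharTwo.add_self_eq_zero (f (P x.vec) (Q x'.vec)) }
  refine ⟨X, fun a => LinearMap.ext fun φ => funext fun y => ?_⟩
  change ψ (a + f (P 0) (Q 0) + (f (P 0) y + f y (P 0))) * φ (y + Q 0) = ψ a * φ y
  simp

theorem IsNondegenerateHermitian.exists_hasCentralCharacter (hf : IsNondegenerateHermitian q f)
    (hr : 1 ≤ r) (hq : q = 2 ^ r) (hK : Nat.card K = q ^ 2) (hV : Module.finrank K V = 2)
    (ψ : AddChar K k) :
    ∃ X : Representation k (HermitianGroup f) (Fin (q ^ 2) → k), HasCentralCharacter X ψ := by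
  have hq1 : 1 ≤ q := by rw [hq]; exact Nat.one_le_two_pow
  obtain ⟨U, hU⟩ := hf.exists_isIsotropicLine hr hq hK hV
  obtain ⟨σ, hσ⟩ := hf.exists_isDiagonalIsometry hr hq hK hV
  have hcompl := hU.isCompl_map_pow hf hq hV hσ ⟨le_rfl, hq1⟩
  set W := U.map (σ ^ 1).1.toLinearMap
  have hW : IsIsotropicLine f W := hU.map _
  obtain ⟨X, hX⟩ := exists_hasCentralCharacter_of_isCompl ψ hU.2 hW.2 hcompl
  have hcard := natCard_of_finrank_eq_one hK hW.1
  have : Finite W := Nat.finite_of_card_ne_zero (by rw [hcard]; positivity)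
  let e : (W → k) ≃ₗ[k] (Fin (q ^ 2) → k) :=
    LinearEquiv.funCongrLeft k k (Finite.equivFinOfCardEq hcard).symm
  refine ⟨((e.conjAlgEquiv k : Module.End k (W → k) →* Module.End k (Fin (q ^ 2) → k))).comp X,
    fun a => ?_⟩
  change e.conjAlgEquiv k (X ⟨0, a⟩) = _
  rw [hX, map_smul, map_one]

/-- A quadratic character separating a nonzero trace from zero. -/
theorem exists_isNontrivialOnTraces [CharZero k] (hq : 2 ≤ q) (hK : Nat.card K = q ^ 2) :
    ∃ ψ : AddChar K k, IsNontrivialOnTraces q ψ := by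
  obtain ⟨t, ht⟩ := exists_add_pow_ne_zero hq hK
  let _ : Algebra (ZMod 2) K := ZMod.algebra K 2
  obtain ⟨l, hl⟩ := Module.Projective.exists_dual_eq_one (ZMod 2) ht
  let χ : AddChar (ZMod 2) k := AddChar.zmodChar 2 (ζ := -1) (by norm_num)
  refine ⟨χ.compAddMonoidHom l.toAddMonoidHom, t, ?_⟩
  change χ (l (t + t ^ q)) ≠ 1
  rw [hl, AddChar.zmodChar_apply, ZMod.val_one, pow_one]
  norm_num

/-- A character of `K` with complex values is real, because `K` has exponent two. -/
theorem AddChar.exists_ofReal_eq (ψ : AddChar K ℂ) : ∃ ψ' : AddChar K ℝ, ∀ a, (ψ' a : ℂ) = ψ a := by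
  have h : ∀ a, ((ψ a).re : ℂ) = ψ a := fun a => by
    rcases ψ.eq_one_or_eq_neg_one_of_charTwo a with h | h <;> simp [h]
  refine ⟨⟨fun a => (ψ a).re, by simp, fun a b => ?_⟩, h⟩
  apply Complex.ofReal_injective
  rw [Complex.ofReal_mul, h, h, h, ψ.map_add_eq_mul]

theorem Representation.IsIrreducible.exists_eq_smul_of_commute {G : Type*} [Group G]
    {E : Type*} [AddCommGroup E] [Module ℂ E] [FiniteDimensional ℂ E] {ρ : Representation ℂ G E}
    (hρ : ρ.IsIrreducible) {A : Module.End ℂ E} (hA : ∀ x, A * ρ x = ρ x * A) :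
    ∃ c : ℂ, A = c • 1 := by
  obtain ⟨c, hc⟩ := (Representation.IsIrreducible.algebraMap_intertwiningMap_bijective_of_isAlgClosed
    (ρ := ρ)).2 ⟨A, hA⟩
  refine ⟨c, ?_⟩
  have := congrArg Representation.IntertwiningMap.toLinearMap hc
  exact this.symm

/-- The center acts on an irreducible representation through scalars. If these were trivial on
commutators, all operators would commute, hence be scalars, and the degree would be one. -/
theorem Representation.IsIrreducible.exists_hasCentralCharacter (hf : IsNondegenerateHermitian q f)
    {E : Type*} [AddCommGroup E] [Module ℂ E] {ρ : Representation ℂ (HermitianGroup f) E}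
    (hρ : ρ.IsIrreducible) (hE : 1 < Module.finrank ℂ E) :
    ∃ ψ : AddChar K ℂ, HasCentralCharacter ρ ψ ∧ IsNontrivialOnTraces q ψ := by
  have : FiniteDimensional ℂ E := Module.finite_of_finrank_pos (by omega)
  have : Nontrivial E := Module.nontrivial_of_finrank_pos (R := ℂ) (by omega)
  have hcomm : ∀ a x, ρ ⟨0, a⟩ * ρ x = ρ x * ρ ⟨0, a⟩ := fun a x => by
    rw [← map_mul, ← map_mul]
    congr 1
    apply HermitianGroup.ext
    · change 0 + x.vec = x.vec + 0
      rw [zero_add, add_zero]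
    · change f 0 x.vec + a + x.scal = f x.vec 0 + x.scal + a
      simp [add_comm]
  choose c hc using fun a => hρ.exists_eq_smul_of_commute (hcomm a)
  have hinj : Function.Injective fun c : ℂ => c • (1 : Module.End ℂ E) :=
    smul_left_injective ℂ one_ne_zero
  let ψ : AddChar K ℂ := ⟨c, hinj ?_, fun a b => hinj ?_⟩
  · have hψ : HasCentralCharacter ρ ψ := hc
    refine ⟨ψ, hψ, ?_⟩
    by_contra hn
    have htr : ∀ t, ψ (t + t ^ q) = 1 := by
      by_contra! h
      exact hn h
    have hscalar : ∀ x, ∃ c : ℂ, ρ x = c • 1 := fun ⟨u, a⟩ =>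
      hρ.exists_eq_smul_of_commute fun ⟨v, b⟩ => by
        rw [hψ.apply_eq, hψ.apply_eq v, smul_mul_smul_comm, smul_mul_smul_comm, hψ.mul_comm u,
          hf.hermitian u v, htr, one_smul, mul_comm (ψ a)]
    obtain ⟨e, he⟩ := exists_ne (0 : E)
    let N : Subrepresentation ρ :=
      ⟨Submodule.span ℂ {e}, fun x y hy => by
        obtain ⟨c, hc⟩ := hscalar x
        rw [hc]
        exact Submodule.smul_mem _ c hy⟩
    have hN : N = ⊤ := (hρ.eq_bot_or_eq_top N).resolve_left fun h => by
      have h1 : e ∈ N.toSubmodule := Submodule.mem_span_singleton_self e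
      rw [h] at h1
      exact he h1
    have h2 : Submodule.span ℂ {e} = ⊤ := congrArg Subrepresentation.toSubmodule hN
    have h3 := finrank_span_singleton (K := ℂ) he
    rw [h2, finrank_top] at h3
    omega
  · change c 0 • (1 : Module.End ℂ E) = (1 : ℂ) • 1
    rw [one_smul, ← hc]
    exact map_one ρ
  · change c (a + b) • (1 : Module.End ℂ E) = (c a * c b) • 1
    rw [← hc, ← smul_smul, ← hc b, ← one_mul (ρ ⟨0, b⟩), ← smul_mul_assoc, ← hc, ← map_mul]
    congr 1
    apply HermitianGroup.ext
    · exact (add_zero 0).symm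
    · change a + b = f 0 0 + a + b
      simp

/-- An involution whose trace is `±` the dimension is a scalar. -/
theorem eq_smul_one_of_mul_self_of_trace [CharZero k] [FiniteDimensional k E] {T : Module.End k E}
    (hT : T * T = 1) {s : k} (hs : s * s = 1)
    (htr : LinearMap.trace k E T = s * Module.finrank k E) : T = s • 1 := by
  have hid : IsIdempotentElem ((2⁻¹ : k) • (1 - s • T)) := by
    rw [IsIdempotentElem, smul_mul_smul_comm]
    have h1 : (1 - s • T) * (1 - s • T) = (2 : k) • (1 - s • T) := by
      rw [sub_mul, mul_sub, mul_sub, smul_mul_smul_comm, hT, hs, one_mul, one_mul, mul_one,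
        one_smul, two_smul]
      abel
    rw [h1, smul_smul]
    norm_num
  have h0 := (LinearMap.IsIdempotentElem.trace_eq_zero_iff hid).1 (by
    rw [map_smul, map_sub, map_smul, htr, LinearMap.trace_one, smul_eq_mul, smul_eq_mul]
    linear_combination (-2⁻¹ * (Module.finrank k E : k)) * hs)
  have h1 : (1 : Module.End k E) = s • T := sub_eq_zero.1
    ((smul_eq_zero.1 h0).resolve_left (by norm_num))
  rw [h1, smul_smul, hs, one_smul]

theorem IsRealFormOf.exists_hasCentralCharacter {d : ℕ}
    {ρ : Representation ℂ (HermitianGroup f) (Fin d → ℂ)}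
    {X : Representation ℝ (HermitianGroup f) (Fin d → ℝ)} (hX : IsRealFormOf X ρ)
    {ψ : AddChar K ℂ} (hρ : HasCentralCharacter ρ ψ) (hψ : IsNontrivialOnTraces q ψ) :
    ∃ ψ' : AddChar K ℝ, HasCentralCharacter X ψ' ∧ IsNontrivialOnTraces q ψ' := by
  obtain ⟨ψ', hψ'⟩ := ψ.exists_ofReal_eq
  obtain ⟨t, ht⟩ := hψ
  refine ⟨ψ', fun a => ?_, t, fun h => ht (by rw [← hψ', h, Complex.ofReal_one])⟩
  refine eq_smul_one_of_mul_self_of_trace ?_ (ψ'.mul_self_of_charTwo a) ?_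
  · rw [← map_mul, ← map_one X]
    congr 1
    apply HermitianGroup.ext
    · exact add_zero 0
    · change f 0 0 + a + a = 0
      rw [map_zero, zero_add, CharTwo.add_self_eq_zero]
  · apply Complex.ofReal_injective
    have h := hX ⟨0, a⟩
    rw [Representation.character, Representation.character, hρ, map_smul, LinearMap.trace_one,
      ← hψ'] at h
    rw [h]
    simp

end Existence

/-! ### Eigenbases of isotropic lines -/

theorem exists_isInvariantForm {G ι : Type*} [Group G] [Finite G] [Fintype ι]
    (X : Representation ℝ G (ι → ℝ)) :
    ∃ B : LinearMap.BilinForm ℝ (ι → ℝ), IsInvariantForm X B := by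
  have := Fintype.ofFinite G
  let B : LinearMap.BilinForm ℝ (ι → ℝ) := ∑ g : G, (dotProductBilin ℝ ℝ).compl₁₂ (X g) (X g)
  have hB : ∀ v w, B v w = ∑ g : G, X g v ⬝ᵥ X g w := fun v w => by
    simp [B, LinearMap.sum_apply]
  refine ⟨B, fun v w => ?_, fun v hv => ?_, fun x v w => ?_⟩
  · rw [hB, hB]
    exact Finset.sum_congr rfl fun g _ => dotProduct_comm _ _
  · rw [hB]
    refine Finset.sum_pos' (fun g _ => ?_) ⟨1, Finset.mem_univ _, ?_⟩
    · exact Finset.sum_nonneg fun i _ => mul_self_nonneg _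
    · rw [map_one, Module.End.one_apply]
      exact lt_of_le_of_ne (Finset.sum_nonneg fun i _ => mul_self_nonneg _)
        fun h => hv (dotProduct_self_eq_zero.1 h.symm)
  · rw [hB, hB]
    exact Fintype.sum_equiv (Equiv.mulRight x) _ _ fun g => by
      simp [map_mul, Module.End.mul_apply]

section Eigenbases

variable {K V : Type*} [Field K] [CharP K 2] [AddCommGroup V] [Module K V] {r q : ℕ}
  {f : V →ₗ[K] V →ₛₗ[iterateFrobenius K 2 r] K}
  {E : Type*} [AddCommGroup E] [Module ℝ E]
  {X : Representation ℝ (HermitianGroup f) E} {B : LinearMap.BilinForm ℝ E} {ψ : AddChar K ℝ}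

theorem finite_hermitianGroup [Finite K] [Finite V] : Finite (HermitianGroup f) :=
  Finite.of_injective (fun x : HermitianGroup f => (x.vec, x.scal)) fun x y h => by
    rw [Prod.mk.injEq] at h
    exact HermitianGroup.ext h.1 h.2

/-- `e` is a simultaneous eigenvector of the operators `X (u, 0)`, `u ∈ U`. -/
def IsLineEigenvector (X : Representation ℝ (HermitianGroup f) E) (U : Submodule K V) (e : E) :
    Prop :=
  ∀ u ∈ U, ∃ c : ℝ, X ⟨u, 0⟩ e = c • e

theorem IsLineEigenvector.apply {U : Submodule K V} {e : E} (he : IsLineEigenvector X U e)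
    (hX : HasCentralCharacter X ψ) (w : V) : IsLineEigenvector X U (X ⟨w, 0⟩ e) := by
  intro u hu
  obtain ⟨c, hc⟩ := he u hu
  refine ⟨ψ (f u w + f w u) * c, ?_⟩
  have h := congrArg (fun A => A e) (hX.mul_comm u w)
  simp only [Module.End.mul_apply, LinearMap.smul_apply, hc, map_smul, smul_smul] at h
  exact h

theorem isLineEigenvector_iff_forall_lineHat {U : Submodule K V} {e : E} :
    IsLineEigenvector X U e ↔ ∀ x ∈ lineHat f U, ∃ c : ℝ, X x e = c • e := by
  constructor
  · rintro h ⟨u, a⟩ ⟨hu, ha⟩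
    obtain rfl : a = 0 := ha
    exact h u hu
  · exact fun h u hu => h _ ⟨hu, rfl⟩

variable [FiniteDimensional ℝ E] (hf : IsNondegenerateHermitian q f)
  (hV : Module.finrank K V = 2) (hψ : IsNontrivialOnTraces q ψ) (hX : HasCentralCharacter X ψ)
  (hB : IsInvariantForm X B)
include hf hV hψ hX hB

/-- The vectors `X (w, 0) e` belong to different characters of `U` for `w` in different cosets of
`U`, and are therefore orthogonal. -/
theorem IsLineEigenvector.isOrthonormalBasis_apply {ι : Type*} [Fintype ι] [DecidableEq ι]
    {U : Submodule K V} (hU : IsIsotropicLine f U) {e : E} (he : IsLineEigenvector X U e)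
    (he1 : B e e = 1) {w : ι → V} (hw : ∀ i j, i ≠ j → w i + w j ∉ U)
    (hcard : Fintype.card ι = Module.finrank ℝ E) :
    IsOrthonormalBasis B (fun i => X ⟨w i, 0⟩ e) := by
  refine .of_card_eq_finrank (fun i j => ?_) hcard
  split_ifs with hij
  · rw [hij, hB.invariant, he1]
  · obtain ⟨t, ht⟩ := hψ
    obtain ⟨u, hu, hut⟩ := hU.exists_apply_eq hf hV (hw i j hij) t
    obtain ⟨c, hc⟩ := he u hu
    have hc2 : c * c = 1 := by
      have := hB.invariant ⟨u, 0⟩ e e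
      rw [hc, map_smul, map_smul, LinearMap.smul_apply, he1] at this
      simpa using this
    have key : ∀ v, X ⟨u, 0⟩ (X ⟨v, 0⟩ e) = (ψ (f u v + f v u) * c) • X ⟨v, 0⟩ e := fun v => by
      have h := congrArg (fun A => A e) (hX.mul_comm u v)
      simp only [Module.End.mul_apply, LinearMap.smul_apply, hc, map_smul, smul_smul] at h
      exact h
    have h1 := hB.invariant ⟨u, 0⟩ (X ⟨w i, 0⟩ e) (X ⟨w j, 0⟩ e)
    rw [key, key, map_smul, map_smul, LinearMap.smul_apply, smul_eq_mul, smul_eq_mul] at h1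
    have h2 : ψ (f u (w i) + f (w i) u) * ψ (f u (w j) + f (w j) u) = ψ (t + t ^ q) := by
      rw [← ψ.map_add_eq_mul, ← hut, ← hf.hermitian]
      congr 1
      simp only [map_add, LinearMap.add_apply]
      ring
    have h3 : (ψ (t + t ^ q) - 1) * B (X ⟨w i, 0⟩ e) (X ⟨w j, 0⟩ e) = 0 := by
      rw [← h2]
      linear_combination h1 - ψ (f u (w i) + f (w i) u) * ψ (f u (w j) + f (w j) u) *
        B (X ⟨w i, 0⟩ e) (X ⟨w j, 0⟩ e) * hc2
    exact (mul_eq_zero.1 h3).resolve_left (sub_ne_zero.2 ht)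

variable (hK : Nat.card K = q ^ 2) [Finite K] (hE : Module.finrank ℝ E = q ^ 2)
include hK hE

/-- The operator `∑ u ∈ U, X (u, 0)` has trace `q ^ 2`, so it is not zero, and `U` fixes its
values. -/
theorem IsIsotropicLine.exists_isLineEigenvector {U : Submodule K V} (hU : IsIsotropicLine f U) :
    ∃ e : E, IsLineEigenvector X U e ∧ B e e = 1 := by
  have : FiniteDimensional K V := Module.finite_of_finrank_pos (by omega)
  have : Finite V := Module.finite_of_finite K
  have := Fintype.ofFinite U
  have hq0 : 0 < q ^ 2 := hK ▸ Nat.card_pos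
  let S : Module.End ℝ E := ∑ u : U, X ⟨u, 0⟩
  have hS : S ≠ 0 := by
    intro h0
    have h1 := congrArg (LinearMap.trace ℝ E) h0
    rw [map_sum, map_zero, Finset.sum_eq_single 0] at h1
    · rw [Submodule.coe_zero, hX.apply_zero, LinearMap.trace_one, hE] at h1
      exact hq0.ne' (by exact_mod_cast h1)
    · intro u _ hu
      exact hX.trace_eq_zero hf hψ fun h => hu (Subtype.ext h)
    · simp
  obtain ⟨y, hy⟩ : ∃ y, S y ≠ 0 := by
    by_contra! h
    exact hS (LinearMap.ext h)
  have hfix : ∀ u ∈ U, X ⟨u, 0⟩ (S y) = S y := by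
    intro u hu
    have : X ⟨u, 0⟩ * S = S := by
      rw [Finset.mul_sum]
      refine Fintype.sum_equiv (Equiv.addLeft ⟨u, hu⟩) _ _ fun v => ?_
      rw [hX.mul, hU.2 u hu v v.2, ψ.map_zero_eq_one, one_smul]
      rfl
    exact congrArg (fun A => A y) this
  have hpos := hB.pos _ hy
  refine ⟨(√(B (S y) (S y)))⁻¹ • S y, fun u hu => ⟨1, ?_⟩, ?_⟩
  · rw [map_smul, hfix u hu, one_smul]
  · rw [map_smul, map_smul, LinearMap.smul_apply, smul_eq_mul, smul_eq_mul, ← mul_assoc,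
      ← mul_inv, Real.mul_self_sqrt hpos.le, inv_mul_cancel₀ hpos.ne']

theorem IsIsotropicLine.exists_eigenbasis {U : Submodule K V} (hU : IsIsotropicLine f U) :
    ∃ b : Module.Basis (Fin (q ^ 2)) ℝ E,
      IsOrthonormalBasis B b ∧ ∀ i, IsLineEigenvector X U (b i) := by
  have : FiniteDimensional K V := Module.finite_of_finrank_pos (by omega)
  have : Finite V := Module.finite_of_finite K
  obtain ⟨e, he, he1⟩ := hU.exists_isLineEigenvector hf hV hψ hX hB hK hE
  obtain ⟨W, hW⟩ := U.exists_isCompl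
  have hW1 : Module.finrank K W = 1 := by
    have := Submodule.finrank_add_eq_of_isCompl hW
    rw [hU.1] at this
    omega
  let w := (Finite.equivFinOfCardEq (natCard_of_finrank_eq_one hK hW1)).symm
  have hw : ∀ i j, i ≠ j → (w i : V) + w j ∉ U := fun i j hij hmem => by
    have h0 : (w i : V) + w j = 0 :=
      Submodule.disjoint_def.1 hW.disjoint _ hmem (W.add_mem (w i).2 (w j).2)
    refine hij (w.injective (Subtype.ext ?_))
    exact eq_of_add_eq_zero_of_charTwo K h0
  have hon := he.isOrthonormalBasis_apply hf hV hψ hX hB hU he1 hw (by rw [hE, Fintype.card_fin])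
  refine ⟨Module.Basis.mk hon.linearIndependent hon.span_eq_top.ge, ?_, fun i => ?_⟩
  · rwa [Module.Basis.coe_mk]
  · rw [Module.Basis.mk_apply]
    exact he.apply hX _

/-- Unit eigenvectors `e` and `e'` of two complementary lines `U` and `U'` are unbiased: in the
orthonormal basis `X (w, 0) e`, `w ∈ U'`, all coefficients of `e'` equal `± B e e'`. -/
theorem IsLineEigenvector.apply_sq_eq {U U' : Submodule K V} (hU : IsIsotropicLine f U)
    (hU' : IsIsotropicLine f U') (hUU' : IsCompl U U') {e e' : E}
    (he : IsLineEigenvector X U e) (he1 : B e e = 1)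
    (he' : IsLineEigenvector X U' e') (he1' : B e' e' = 1) : B e e' ^ 2 = 1 / (q : ℝ) ^ 2 := by
  classical
  have hcard := natCard_of_finrank_eq_one hK hU'.1
  have hq0 : q ^ 2 ≠ 0 := (hK ▸ Nat.card_pos : 0 < q ^ 2).ne'
  have : Finite U' := Nat.finite_of_card_ne_zero (by rw [hcard]; exact hq0)
  have := Fintype.ofFinite U'
  rw [Nat.card_eq_fintype_card] at hcard
  have hw : ∀ i j : U', i ≠ j → (i : V) + j ∉ U := fun i j hij hmem => by
    have h0 : (i : V) + j = 0 :=
      Submodule.disjoint_def.1 hUU'.disjoint _ hmem (U'.add_mem i.2 j.2)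
    refine hij (Subtype.ext ?_)
    exact eq_of_add_eq_zero_of_charTwo K h0
  have hon := he.isOrthonormalBasis_apply hf hV hψ hX hB hU he1 hw (by rw [hE, hcard])
  have hcoef : ∀ w : U', B (X ⟨w, 0⟩ e) e' ^ 2 = B e e' ^ 2 := fun w => by
    obtain ⟨c, hc⟩ := he' w w.2
    have hc2 : c ^ 2 = 1 := by
      have := hB.invariant ⟨w, 0⟩ e' e'
      rw [hc, map_smul, map_smul, LinearMap.smul_apply, he1'] at this
      simpa [sq] using this
    rw [← hB.invariant ⟨w, 0⟩ e e', hc, map_smul, smul_eq_mul, mul_pow, hc2, one_mul]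
  have h := hon.apply_self_eq_sum_sq e'
  rw [he1', Finset.sum_congr rfl fun w _ => hcoef w, Finset.sum_const, Finset.card_univ, hcard,
    nsmul_eq_mul, Nat.cast_pow] at h
  exact eq_one_div_of_mul_eq_one_right h.symm

end Eigenbases

/-! ### Normalized intertwiners -/

theorem Odd.exists_real_pow_eq {n : ℕ} (hn : Odd n) (c : ℝ) : ∃ d : ℝ, d ^ n = c := by
  have hn0 : n ≠ 0 := hn.pos.ne'
  rcases le_total 0 c with h | h
  · exact ⟨c ^ (n : ℝ)⁻¹, Real.rpow_inv_natCast_pow h hn0⟩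
  · refine ⟨-(-c) ^ (n : ℝ)⁻¹, ?_⟩
    rw [hn.neg_pow, Real.rpow_inv_natCast_pow (neg_nonneg.2 h) hn0, neg_neg]

theorem IsInvariantForm.eq_of_forall_apply_eq {G W : Type*} [Group G] [AddCommGroup W] [Module ℝ W]
    {X : Representation ℝ G W} {B : LinearMap.BilinForm ℝ W} (hB : IsInvariantForm X B) {v v' : W}
    (h : ∀ w, B v w = B v' w) : v = v' := by
  by_contra hne
  have h1 := hB.pos _ (sub_ne_zero.2 hne)
  simp [h] at h1

section Intertwiners

variable {K V : Type*} [Field K] [CharP K 2] [AddCommGroup V] [Module K V] {r q : ℕ}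
  {f : V →ₗ[K] V →ₛₗ[iterateFrobenius K 2 r] K}
  {E : Type*} [AddCommGroup E] [Module ℝ E]
  {X : Representation ℝ (HermitianGroup f) E} {B : LinearMap.BilinForm ℝ E} {ψ : AddChar K ℝ}
  {σ : isometryGroup f}

theorem apply_pow_of_intertwines {D : E ≃ₗ[ℝ] E}
    (hD : ∀ x e, X (isometryHat f σ x) (D e) = D (X x e)) (n : ℕ) (v : V) (e : E) :
    X ⟨(σ ^ n).1 v, 0⟩ ((D ^ n) e) = (D ^ n) (X ⟨v, 0⟩ e) := by
  induction n with
  | zero => rfl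
  | succ n ih =>
    rw [isometryGroup_coe_pow_succ_apply, pow_succ']
    change X (isometryHat f σ ⟨(σ ^ n).1 v, 0⟩) (D ((D ^ n) e)) = D ((D ^ n) (X ⟨v, 0⟩ e))
    rw [hD, ih]

theorem IsNormalizedIntertwiner.intertwines {α : MulAut (HermitianGroup f)} {D : E ≃ₗ[ℝ] E}
    (hD : IsNormalizedIntertwiner q X B α D) (x : HermitianGroup f) (e : E) :
    X (α x) (D e) = D (X x e) := by
  rw [hD.conj]
  congr 2
  exact D.symm_apply_apply e

theorem IsNormalizedIntertwiner.preserves_pow {α : MulAut (HermitianGroup f)} {D : E ≃ₗ[ℝ] E}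
    (hD : IsNormalizedIntertwiner q X B α D) (n : ℕ) (v w : E) :
    B ((D ^ n) v) ((D ^ n) w) = B v w := by
  induction n with
  | zero => rfl
  | succ n ih =>
    rw [pow_succ', ← ih]
    exact hD.preserves _ _

theorem IsNormalizedIntertwiner.isLineEigenvector_pow {D : E ≃ₗ[ℝ] E}
    (hD : IsNormalizedIntertwiner q X B (isometryHat f σ) D) {U : Submodule K V} {e : E}
    (he : IsLineEigenvector X U e) (n : ℕ) :
    IsLineEigenvector X (U.map (σ ^ n).1.toLinearMap) ((D ^ n) e) := by
  rintro _ ⟨u, hu, rfl⟩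
  obtain ⟨c, hc⟩ := he u hu
  refine ⟨c, ?_⟩
  rw [← map_smul, ← hc]
  exact apply_pow_of_intertwines hD.intertwines n u e

variable [FiniteDimensional ℝ E] [Finite K] (hf : IsNondegenerateHermitian q f)
  (hK : Nat.card K = q ^ 2) (hV : Module.finrank K V = 2) (hE : Module.finrank ℝ E = q ^ 2)
  (hψ : IsNontrivialOnTraces q ψ) (hX : HasCentralCharacter X ψ) (hB : IsInvariantForm X B)
include hf hK hV hE hψ hX hB

/-- Invariant forms are unique up to scalars. -/
theorem exists_eq_smul_of_invariant {B' : LinearMap.BilinForm ℝ E}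
    (hB' : ∀ x v w, B' (X x v) (X x w) = B' v w) : ∃ s : ℝ, ∀ v w, B' v w = s * B v w := by
  have hnd : B.Nondegenerate := by
    refine ⟨fun v h => hB.eq_of_forall_apply_eq (by simpa using h), fun v h => ?_⟩
    exact hB.eq_of_forall_apply_eq fun w => by rw [hB.symm, h, map_zero, LinearMap.zero_apply]
  -- Schur's lemma applies to the operator `A` with `B (A v) w = B' v w`
  let A : Module.End ℝ E := B'.symmCompOfNondegenerate B hnd
  have hA : ∀ v w, B (A v) w = B' v w := fun v w =>
    B'.symmCompOfNondegenerate_left_apply hnd w v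
  obtain ⟨s, hs⟩ := hX.exists_eq_smul_of_commute hf hψ hK hV hE (A := A) fun v => by
    refine LinearMap.ext fun e => hB.eq_of_forall_apply_eq fun w => ?_
    have hw : X ⟨v, 0⟩ (X (⟨v, 0⟩⁻¹) w) = w := by
      rw [← Module.End.mul_apply, ← map_mul, mul_inv_cancel, map_one, Module.End.one_apply]
    rw [Module.End.mul_apply, Module.End.mul_apply, hA, ← hw, hB', hB.invariant, hA]
  exact ⟨s, fun v w => by rw [← hA, hs]; simp⟩

/-- If `D₀` implements `σ`, then `D₀ ^ (q + 1)` is a scalar. As `q + 1` is odd, this scalar has a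
real `(q + 1)`-th root, and division by it normalizes `D₀`; preservation of `B` is automatic. -/
theorem exists_isNormalizedIntertwiner (hq : Even q) (hσ : σ ^ (q + 1) = 1) :
    ∃ D : E ≃ₗ[ℝ] E, IsNormalizedIntertwiner q X B (isometryHat f σ) D := by
  have : Nontrivial E := Module.nontrivial_of_finrank_pos (R := ℝ)
    (by rw [hE, ← hK]; exact Nat.card_pos)
  obtain ⟨e, he⟩ := exists_ne (0 : E)
  obtain ⟨D₀, hD₀⟩ := hX.exists_intertwiner hf hψ hK hV hE (hX.comp_isometryHat σ)
  replace hD₀ : ∀ x e, X (isometryHat f σ x) (D₀ e) = D₀ (X x e) := hD₀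
  obtain ⟨c, hc⟩ := hX.exists_eq_smul_of_commute hf hψ hK hV hE
    (A := (D₀ ^ (q + 1)).toLinearMap) fun v => LinearMap.ext fun e => by
      have h := apply_pow_of_intertwines hD₀ (q + 1) v e
      rw [hσ] at h
      exact h.symm
  replace hc : ∀ e, (D₀ ^ (q + 1)) e = c • e := fun e => congrArg (fun A => A e) hc
  have hc0 : c ≠ 0 := by
    rintro rfl
    have := hc e
    rw [zero_smul, LinearEquiv.map_eq_zero_iff] at this
    exact he this
  obtain ⟨d, hd⟩ := hq.add_one.exists_real_pow_eq c
  have hd0 : d ≠ 0 := by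
    rintro rfl
    exact hc0 (by rw [← hd, zero_pow (by omega)])
  let D : E ≃ₗ[ℝ] E := D₀.trans (LinearEquiv.smulOfNeZero ℝ E d⁻¹ (inv_ne_zero hd0))
  have hD : ∀ e, D e = d⁻¹ • D₀ e := fun e => rfl
  have hint : ∀ x e, X (isometryHat f σ x) (D e) = D (X x e) := fun x e => by
    rw [hD, hD, map_smul, hD₀]
  have hDn : ∀ n e, (D ^ n) e = (d⁻¹) ^ n • (D₀ ^ n) e := by
    intro n
    induction n with
    | zero => simp
    | succ n ih =>
      intro e
      rw [pow_succ' D, pow_succ' D₀]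
      change D ((D ^ n) e) = _ • D₀ ((D₀ ^ n) e)
      rw [ih, hD, map_smul, smul_smul, pow_succ']
  have hpow : D ^ (q + 1) = 1 := LinearEquiv.ext fun e => by
    rw [hDn, hc, inv_pow, hd, smul_smul, inv_mul_cancel₀ hc0, one_smul]
    rfl
  obtain ⟨s, hs⟩ := exists_eq_smul_of_invariant hf hK hV hE hψ hX hB
    (B' := B.compl₁₂ D.toLinearMap D.toLinearMap) fun x v w => by
      change B (D (X x v)) (D (X x w)) = B (D v) (D w)
      rw [← hint, ← hint, hB.invariant]
  replace hs : ∀ v w, B (D v) (D w) = s * B v w := hs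
  have hs0 : 0 < s := by
    have h1 := hB.pos (D e) (by rwa [Ne, LinearEquiv.map_eq_zero_iff])
    rw [hs] at h1
    exact pos_of_mul_pos_left h1 (hB.pos e he).le
  have hsn : ∀ n, B ((D ^ n) e) ((D ^ n) e) = s ^ n * B e e := by
    intro n
    induction n with
    | zero => simp
    | succ n ih =>
      rw [pow_succ' D]
      change B (D ((D ^ n) e)) (D ((D ^ n) e)) = _
      rw [hs, ih, pow_succ', mul_assoc]
  have hs1 : s = 1 := by
    have h1 := hsn (q + 1)
    rw [hpow] at h1
    have h2 : s ^ (q + 1) = 1 :=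
      mul_right_cancel₀ (hB.pos e he).ne' (h1.symm.trans (one_mul _).symm)
    exact (pow_eq_one_iff_of_nonneg hs0.le q.succ_ne_zero).1 h2
  refine ⟨D, fun x w => ?_, hpow, fun v w => by rw [hs, hs1, one_mul]⟩
  rw [← hint]
  congr 1
  exact (D.apply_symm_apply w).symm

omit [FiniteDimensional ℝ E] [Finite K] hf hK hV hE hψ hX hB

theorem IsOrthonormalBasis.repr_eq {ι : Type*} [Fintype ι] [DecidableEq ι]
    {b : Module.Basis ι ℝ E} (hb : IsOrthonormalBasis B b) (x : E) (i : ι) :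
    b.repr x i = B (b i) x := by
  conv_lhs => rw [hb.eq_sum x]
  simp [Finsupp.single_apply]

theorem IsOrthonormalBasis.toMatrix_mem_orthogonalGroup {ι : Type*} [Fintype ι] [DecidableEq ι]
    {b : Module.Basis ι ℝ E} (hb : IsOrthonormalBasis B b) {D : E ≃ₗ[ℝ] E}
    (hsymm : ∀ v w, B v w = B w v) (hD : ∀ v w, B (D v) (D w) = B v w) :
    LinearMap.toMatrix b b D.toLinearMap ∈ Matrix.orthogonalGroup ι ℝ := by
  rw [Matrix.mem_orthogonalGroup_iff']
  ext i j
  rw [Matrix.mul_apply, Matrix.one_apply, ← hb.orthonormal i j, ← hD (b i) (b j)]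
  conv_rhs => rw [hb.eq_sum (D (b j))]
  rw [map_sum]
  refine Finset.sum_congr rfl fun s _ => ?_
  rw [Matrix.transpose_apply, LinearMap.toMatrix_apply, LinearMap.toMatrix_apply, hb.repr_eq,
    hb.repr_eq, map_smul, smul_eq_mul, hsymm (D (b i)), mul_comm]
  rfl

end Intertwiners

/-! ### Bases obtained from the group -/

section Conclusion

variable {K V : Type*} [Field K] [CharP K 2] [AddCommGroup V] [Module K V] {r q : ℕ}
  {f : V →ₗ[K] V →ₛₗ[iterateFrobenius K 2 r] K}
  {E : Type*} [AddCommGroup E] [Module ℝ E] [FiniteDimensional ℝ E] [Finite K]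
  {X : Representation ℝ (HermitianGroup f) E} {B : LinearMap.BilinForm ℝ E} {ψ : AddChar K ℝ}
  {σ : isometryGroup f}

/-- The basis `b` and its image under `D ^ m` are eigenbases of the different isotropic lines `U`
and `σ ^ m U`, hence unbiased. -/
theorem IsNormalizedIntertwiner.apply_pow_sq_eq (hf : IsNondegenerateHermitian q f)
    (hq : q = 2 ^ r) (hK : Nat.card K = q ^ 2) (hV : Module.finrank K V = 2)
    (hE : Module.finrank ℝ E = q ^ 2) (hψ : IsNontrivialOnTraces q ψ)
    (hX : HasCentralCharacter X ψ) (hB : IsInvariantForm X B) (hσ : IsDiagonalIsometry q f σ)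
    {D : E ≃ₗ[ℝ] E} (hD : IsNormalizedIntertwiner q X B (isometryHat f σ) D)
    {U : Submodule K V} (hU : IsIsotropicLine f U) {e e' : E} (he : IsLineEigenvector X U e)
    (he1 : B e e = 1) (he' : IsLineEigenvector X U e') (he1' : B e' e' = 1) {m : ℕ}
    (hm : m ∈ Set.Icc 1 q) : B e ((D ^ m) e') ^ 2 = 1 / (q : ℝ) ^ 2 :=
  he.apply_sq_eq hf hV hψ hX hB hK hE hU (hU.map (σ ^ m))
    (hU.isCompl_map_pow hf hq hV hσ hm) he1 (hD.isLineEigenvector_pow he' m)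
    ((hD.preserves_pow m e' e').trans he1')

variable {ι : Type*} [Fintype ι] [DecidableEq ι] {b : Module.Basis ι ℝ E}

omit [FiniteDimensional ℝ E] [Finite K] in
theorem IsNormalizedIntertwiner.isOrthonormalBasis_pow {α : MulAut (HermitianGroup f)}
    {D : E ≃ₗ[ℝ] E} (hD : IsNormalizedIntertwiner q X B α D) (hb : IsOrthonormalBasis B b)
    (n : ℕ) : IsOrthonormalBasis B (fun i => (D ^ n) (b i)) := by
  have := b.finiteDimensional_of_finite
  refine .of_card_eq_finrank (fun i j => ?_) (Module.finrank_eq_card_basis b).symm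
  rw [hD.preserves_pow, hb.orthonormal]

omit [FiniteDimensional ℝ E] [Finite K] in
theorem IsNormalizedIntertwiner.mutuallyUnbiased_pow {α : MulAut (HermitianGroup f)}
    {D : E ≃ₗ[ℝ] E} (hD : IsNormalizedIntertwiner q X B α D) (hB : IsInvariantForm X B)
    (hb : IsOrthonormalBasis B b) (hcard : Fintype.card ι = q ^ 2)
    (h : ∀ m ∈ Set.Icc 1 q, ∀ i j, B (b i) ((D ^ m) (b j)) ^ 2 = 1 / (q : ℝ) ^ 2) {j k : ℕ}
    (hj : j ∈ Set.Icc 1 (q + 1)) (hk : k ∈ Set.Icc 1 (q + 1)) (hjk : j ≠ k) :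
    MutuallyUnbiased B (fun i => (D ^ j) (b i)) (fun i => (D ^ k) (b i)) := by
  have key : ∀ j ∈ Set.Icc 1 (q + 1), ∀ k ∈ Set.Icc 1 (q + 1), j < k → ∀ i l,
      B ((D ^ j) (b i)) ((D ^ k) (b l)) ^ 2 = 1 / (Fintype.card ι : ℝ) := by
    intro j hj k hk hlt i l
    rw [← Nat.add_sub_cancel' hlt.le, pow_add, hcard, Nat.cast_pow]
    have hm : k - j ∈ Set.Icc 1 q := ⟨by omega, by have := hj.1; have := hk.2; omega⟩
    rw [← h _ hm i l, ← hD.preserves_pow j (b i)]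
    rfl
  refine ⟨hD.isOrthonormalBasis_pow hb j, hD.isOrthonormalBasis_pow hb k, fun i l => ?_⟩
  rcases lt_or_gt_of_ne hjk with hlt | hlt
  · exact key j hj k hk hlt i l
  · rw [hB.symm]
    exact key k hk j hj hlt l i

omit [FiniteDimensional ℝ E] [Finite K] in
theorem toMatrix_linearEquiv_pow (D : E ≃ₗ[ℝ] E) (n : ℕ) :
    LinearMap.toMatrix b b D.toLinearMap ^ n = LinearMap.toMatrix b b (D ^ n).toLinearMap := by
  rw [LinearMap.toMatrix_pow]
  congr 1
  exact (map_pow (LinearEquiv.automorphismGroup.toLinearMapMonoidHom (R := ℝ) (M := E)) D n).symm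

omit [FiniteDimensional ℝ E] in
theorem IsOrthonormalBasis.hasFlatPowers_toMatrix (hb : IsOrthonormalBasis B b) {D : E ≃ₗ[ℝ] E}
    (h : ∀ m ∈ Set.Icc 1 q, ∀ i j, B (b i) ((D ^ m) (b j)) ^ 2 = 1 / (q : ℝ) ^ 2) :
    HasFlatPowers q (LinearMap.toMatrix b b D.toLinearMap) := by
  intro m hm i j
  rw [toMatrix_linearEquiv_pow, LinearMap.toMatrix_apply, hb.repr_eq]
  exact h m hm i j

end Conclusion

/-- All assertions about the group attached to a given hermitian plane. The nontrivial central
character `ψ` of the complex representation determines it and its real form. -/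
theorem IsNondegenerateHermitian.realForms_and_unbiasedBases {r q : ℕ} (hr : 1 ≤ r)
    (hq : q = 2 ^ r) {K V : Type*} [Field K] [CharP K 2] [AddCommGroup V] [Module K V]
    (f : V →ₗ[K] V →ₛₗ[iterateFrobenius K 2 r] K)
    (hK : Nat.card K = q ^ 2) (hV : Module.finrank K V = 2)
    (hf : IsNondegenerateHermitian q f) :
      (∃ U : Submodule K V, IsIsotropicLine f U) ∧
      (∃ σ : isometryGroup f, IsDiagonalIsometry q f σ) ∧
      (∀ σ : isometryGroup f, IsDiagonalIsometry q f σ → orderOf σ = q + 1) ∧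
      (∃ ρ : Representation ℂ (HermitianGroup f) (Fin (q ^ 2) → ℂ), ρ.IsIrreducible) ∧
      ∀ ρ : Representation ℂ (HermitianGroup f) (Fin (q ^ 2) → ℂ), ρ.IsIrreducible →
        (∃ X : Representation ℝ (HermitianGroup f) (Fin (q ^ 2) → ℝ), IsRealFormOf X ρ) ∧
        ∀ X : Representation ℝ (HermitianGroup f) (Fin (q ^ 2) → ℝ), IsRealFormOf X ρ →
          (∃ B : LinearMap.BilinForm ℝ (Fin (q ^ 2) → ℝ), IsInvariantForm X B) ∧
          ∀ B : LinearMap.BilinForm ℝ (Fin (q ^ 2) → ℝ), IsInvariantForm X B →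
          ∀ σ : isometryGroup f, IsDiagonalIsometry q f σ →
            (∃ D : (Fin (q ^ 2) → ℝ) ≃ₗ[ℝ] (Fin (q ^ 2) → ℝ),
              IsNormalizedIntertwiner q X B (isometryHat f σ) D) ∧
            ∀ U : Submodule K V, IsIsotropicLine f U →
              (∃ b : Module.Basis (Fin (q ^ 2)) ℝ (Fin (q ^ 2) → ℝ),
                IsOrthonormalBasis B b ∧ ∀ x ∈ lineHat f U, ∀ i, ∃ c : ℝ, X x (b i) = c • b i) ∧
              ∀ D : (Fin (q ^ 2) → ℝ) ≃ₗ[ℝ] (Fin (q ^ 2) → ℝ),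
                IsNormalizedIntertwiner q X B (isometryHat f σ) D →
              ∀ b : Module.Basis (Fin (q ^ 2)) ℝ (Fin (q ^ 2) → ℝ),
                IsOrthonormalBasis B b →
                (∀ x ∈ lineHat f U, ∀ i, ∃ c : ℝ, X x (b i) = c • b i) →
                (∀ j ∈ Set.Icc 1 (q + 1), ∀ k ∈ Set.Icc 1 (q + 1), j ≠ k →
                  MutuallyUnbiased B (fun i => (D ^ j) (b i)) (fun i => (D ^ k) (b i))) ∧
                LinearMap.toMatrix b b D.toLinearMap ∈ Matrix.orthogonalGroup (Fin (q ^ 2)) ℝ ∧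
                LinearMap.toMatrix b b D.toLinearMap ^ (q + 1) = 1 ∧
                orderOf (LinearMap.toMatrix b b D.toLinearMap) = q + 1 ∧
                PowersMutuallyUnbiased q (LinearMap.toMatrix b b D.toLinearMap) ∧
                PowersHadamard q (LinearMap.toMatrix b b D.toLinearMap) := by
  have hq2 : 2 ≤ q := by rw [hq]; exact Nat.le_self_pow (by omega) 2
  have hfinK := finite_of_card_eq_sq hq2 hK
  have : FiniteDimensional K V := Module.finite_of_finrank_pos (by omega)
  have : Finite V := Module.finite_of_finite K
  have : Finite (HermitianGroup f) := finite_hermitianGroup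
  have hE : ∀ k : Type, [Field k] → Module.finrank k (Fin (q ^ 2) → k) = q ^ 2 := fun k _ => by simp
  refine ⟨hf.exists_isIsotropicLine hr hq hK hV, hf.exists_isDiagonalIsometry hr hq hK hV,
    fun σ hσ => hσ.orderOf_eq hf hq hV, ?_, fun ρ hρ => ?_⟩
  · obtain ⟨ψ, hψ⟩ := exists_isNontrivialOnTraces (k := ℂ) hq2 hK
    obtain ⟨ρ, hρ⟩ := hf.exists_hasCentralCharacter hr hq hK hV ψ
    exact ⟨ρ, hρ.isIrreducible hf hψ hK hV (hE ℂ)⟩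
  obtain ⟨ψ, hρψ, hψ⟩ := hρ.exists_hasCentralCharacter hf (by rw [hE ℂ]; nlinarith)
  constructor
  · obtain ⟨ψ', hψψ'⟩ := ψ.exists_ofReal_eq
    have hψ' : IsNontrivialOnTraces q ψ' := by
      obtain ⟨t, ht⟩ := hψ
      exact ⟨t, fun h => ht (by rw [← hψψ', h, Complex.ofReal_one])⟩
    obtain ⟨X, hX⟩ := hf.exists_hasCentralCharacter hr hq hK hV ψ'
    refine ⟨X, fun x => ?_⟩
    rw [hX.character_eq hf hψ', hρψ.character_eq hf hψ, hE ℝ, hE ℂ]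
    split_ifs <;> simp [hψψ']
  intro X hXρ
  obtain ⟨ψ', hX, hψ'⟩ := hXρ.exists_hasCentralCharacter hρψ hψ
  refine ⟨exists_isInvariantForm X, fun B hB σ hσ => ⟨?_, fun U hU => ⟨?_, ?_⟩⟩⟩
  · refine exists_isNormalizedIntertwiner hf hK hV (hE ℝ) hψ' hX hB ?_ ?_
    · rw [hq]
      exact even_two.pow_of_ne_zero (by omega)
    · rw [← hσ.orderOf_eq hf hq hV, pow_orderOf_eq_one]
  · obtain ⟨b, hb, hbU⟩ := hU.exists_eigenbasis hf hV hψ' hX hB hK (hE ℝ)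
    exact ⟨b, hb, fun x hx i => isLineEigenvector_iff_forall_lineHat.1 (hbU i) x hx⟩
  intro D hD b hb hbU
  have hbU' : ∀ i, IsLineEigenvector X U (b i) := fun i =>
    isLineEigenvector_iff_forall_lineHat.2 fun x hx => hbU x hx i
  have hb1 : ∀ i, B (b i) (b i) = 1 := fun i => by rw [hb.orthonormal, if_pos rfl]
  have hflat : ∀ m ∈ Set.Icc 1 q, ∀ i j, B (b i) ((D ^ m) (b j)) ^ 2 = 1 / (q : ℝ) ^ 2 :=
    fun m hm i j => hD.apply_pow_sq_eq hf hq hK hV (hE ℝ) hψ' hX hB hσ hU (hbU' i) (hb1 i)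
      (hbU' j) (hb1 j) hm
  have hcard : Fintype.card (Fin (q ^ 2)) = q ^ 2 := Fintype.card_fin _
  have hM := hb.toMatrix_mem_orthogonalGroup hB.symm hD.preserves
  have hpow : LinearMap.toMatrix b b D.toLinearMap ^ (q + 1) = 1 := by
    rw [toMatrix_linearEquiv_pow, hD.pow_eq_one]
    exact LinearMap.toMatrix_one b
  have hMflat := hb.hasFlatPowers_toMatrix hflat
  exact ⟨fun j hj k hk hjk => hD.mutuallyUnbiased_pow hB hb hcard hflat hj hk hjk, hM, hpow,
    hMflat.orderOf_eq hq2 hcard hpow,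
    (powersMutuallyUnbiased_iff_hasFlatPowers hcard hM hpow).2 hMflat,
    (powersHadamard_iff_hasFlatPowers hq2 hcard hM).2 hMflat⟩

/-- The standard hermitian form `∑ i, u i * (v i) ^ q` on the plane `K ^ 2`. -/
theorem exists_isNondegenerateHermitian {r q : ℕ} (hq : q = 2 ^ r) {K : Type*} [Field K]
    [CharP K 2] [Finite K] (hK : Nat.card K = q ^ 2) :
    ∃ f : (Fin 2 → K) →ₗ[K] (Fin 2 → K) →ₛₗ[iterateFrobenius K 2 r] K,
      IsNondegenerateHermitian q f := by
  let τ := iterateFrobenius K 2 r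
  have hτ : ∀ x, τ x = x ^ q := fun x => by rw [iterateFrobenius_def, hq]
  have hττ : ∀ x : K, τ (τ x) = x := fun x => by
    have := Fintype.ofFinite K
    rw [hτ, hτ, ← pow_mul, ← sq, ← hK, Nat.card_eq_fintype_card, FiniteField.pow_card]
  let f : (Fin 2 → K) →ₗ[K] (Fin 2 → K) →ₛₗ[τ] K :=
    LinearMap.mk₂'ₛₗ (RingHom.id K) τ (fun u v => u 0 * τ (v 0) + u 1 * τ (v 1))
      (fun u u' v => by simp only [Pi.add_apply]; ring)
      (fun c u v => by simp only [Pi.smul_apply, smul_eq_mul, RingHom.id_apply]; ring)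
      (fun u v v' => by simp only [Pi.add_apply, map_add]; ring)
      (fun c u v => by simp only [Pi.smul_apply, smul_eq_mul, map_mul]; ring)
  have hfuv : ∀ u v, f u v = u 0 * τ (v 0) + u 1 * τ (v 1) := fun u v => rfl
  refine ⟨f, fun u v => ?_, fun u hu => ?_⟩
  · rw [← hτ, hfuv, hfuv, map_add, map_mul, map_mul, hττ, hττ, mul_comm (v 0), mul_comm (v 1)]
  · have h0 := hu (Pi.single 0 1)
    have h1 := hu (Pi.single 1 1)
    rw [hfuv] at h0 h1
    ext i
    fin_cases i
    · simpa using h0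
    · simpa using h1

theorem mainTheorem1 (r q : ℕ) (hr : 1 ≤ r) (hq : q = 2 ^ r) :
    -- there is a matrix as required
    (∃ D : Matrix (Fin (q ^ 2)) (Fin (q ^ 2)) ℝ,
      D ∈ Matrix.orthogonalGroup (Fin (q ^ 2)) ℝ ∧ D ^ (q + 1) = 1 ∧ orderOf D = q + 1 ∧
        PowersMutuallyUnbiased q D ∧ PowersHadamard q D) ∧
    -- the two formulations of the conclusion are equivalent
    (∀ D : Matrix (Fin (q ^ 2)) (Fin (q ^ 2)) ℝ,
      D ∈ Matrix.orthogonalGroup (Fin (q ^ 2)) ℝ → D ^ (q + 1) = 1 →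
        (PowersMutuallyUnbiased q D ↔ PowersHadamard q D)) ∧
    -- such matrices come from the group attached to any non-degenerate hermitian plane
    (∀ {K V : Type*} [Field K] [CharP K 2] [AddCommGroup V] [Module K V]
      (f : V →ₗ[K] V →ₛₗ[iterateFrobenius K 2 r] K),
      Nat.card K = q ^ 2 → Module.finrank K V = 2 → IsNondegenerateHermitian q f →
      (∃ U : Submodule K V, IsIsotropicLine f U) ∧
      (∃ σ : isometryGroup f, IsDiagonalIsometry q f σ) ∧
      (∀ σ : isometryGroup f, IsDiagonalIsometry q f σ → orderOf σ = q + 1) ∧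
      (∃ ρ : Representation ℂ (HermitianGroup f) (Fin (q ^ 2) → ℂ), ρ.IsIrreducible) ∧
      ∀ ρ : Representation ℂ (HermitianGroup f) (Fin (q ^ 2) → ℂ), ρ.IsIrreducible →
        (∃ X : Representation ℝ (HermitianGroup f) (Fin (q ^ 2) → ℝ), IsRealFormOf X ρ) ∧
        ∀ X : Representation ℝ (HermitianGroup f) (Fin (q ^ 2) → ℝ), IsRealFormOf X ρ →
          (∃ B : LinearMap.BilinForm ℝ (Fin (q ^ 2) → ℝ), IsInvariantForm X B) ∧
          ∀ B : LinearMap.BilinForm ℝ (Fin (q ^ 2) → ℝ), IsInvariantForm X B →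
          ∀ σ : isometryGroup f, IsDiagonalIsometry q f σ →
            (∃ D : (Fin (q ^ 2) → ℝ) ≃ₗ[ℝ] (Fin (q ^ 2) → ℝ),
              IsNormalizedIntertwiner q X B (isometryHat f σ) D) ∧
            ∀ U : Submodule K V, IsIsotropicLine f U →
              (∃ b : Module.Basis (Fin (q ^ 2)) ℝ (Fin (q ^ 2) → ℝ),
                IsOrthonormalBasis B b ∧ ∀ x ∈ lineHat f U, ∀ i, ∃ c : ℝ, X x (b i) = c • b i) ∧
              ∀ D : (Fin (q ^ 2) → ℝ) ≃ₗ[ℝ] (Fin (q ^ 2) → ℝ),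
                IsNormalizedIntertwiner q X B (isometryHat f σ) D →
              ∀ b : Module.Basis (Fin (q ^ 2)) ℝ (Fin (q ^ 2) → ℝ),
                IsOrthonormalBasis B b →
                (∀ x ∈ lineHat f U, ∀ i, ∃ c : ℝ, X x (b i) = c • b i) →
                -- the bases `D ^ k b`, `1 ≤ k ≤ q + 1`, are mutually unbiased for `B`
                (∀ j ∈ Set.Icc 1 (q + 1), ∀ k ∈ Set.Icc 1 (q + 1), j ≠ k →
                  MutuallyUnbiased B (fun i => (D ^ j) (b i)) (fun i => (D ^ k) (b i))) ∧
                -- and so are the matrices of the powers of `D` with respect to `b`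
                LinearMap.toMatrix b b D.toLinearMap ∈ Matrix.orthogonalGroup (Fin (q ^ 2)) ℝ ∧
                LinearMap.toMatrix b b D.toLinearMap ^ (q + 1) = 1 ∧
                orderOf (LinearMap.toMatrix b b D.toLinearMap) = q + 1 ∧
                PowersMutuallyUnbiased q (LinearMap.toMatrix b b D.toLinearMap) ∧
                PowersHadamard q (LinearMap.toMatrix b b D.toLinearMap)) := by
  have hq2 : 2 ≤ q := by rw [hq]; exact Nat.le_self_pow (by omega) 2
  have hcard : Fintype.card (Fin (q ^ 2)) = q ^ 2 := Fintype.card_fin _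
  refine ⟨?_, fun D hD hpow => (powersMutuallyUnbiased_iff_hasFlatPowers hcard hD hpow).trans
    (powersHadamard_iff_hasFlatPowers hq2 hcard hD).symm,
    fun f hK hV hf => hf.realForms_and_unbiasedBases hr hq f hK hV⟩
  have hK : Nat.card (GaloisField 2 (2 * r)) = q ^ 2 := by
    rw [GaloisField.card 2 (2 * r) (by omega), hq, ← pow_mul, mul_comm]
  obtain ⟨f, hf⟩ := exists_isNondegenerateHermitian hq hK
  obtain ⟨⟨U, hU⟩, ⟨σ, hσ⟩, -, ⟨ρ, hρ⟩, hrest⟩ :=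
    hf.realForms_and_unbiasedBases hr hq f hK (by simp)
  obtain ⟨⟨X, hX⟩, hrest⟩ := hrest ρ hρ
  obtain ⟨⟨B, hB⟩, hrest⟩ := hrest X hX
  obtain ⟨⟨D, hD⟩, hrest⟩ := hrest B hB σ hσ
  obtain ⟨⟨b, hb, hbU⟩, hrest⟩ := hrest U hU
  exact ⟨LinearMap.toMatrix b b D.toLinearMap, (hrest D hD b hb hbU).2⟩
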